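/- Let $X_0$ be a complex Hilbert space and $U=\mathbb C^m$. Let $\mathcal A: D(\mathcal A)\subset X_0\to X_0$ and $\mathcal B: D(\mathcal A)\to U$ be linear operators such that $\mathcal B$ is onto $U$ and the restriction $A_0$ of $\mathcal A$ to $D(A_0)=D(\mathcal A)\cap\ker\mathcal B$ generates a strongly continuous semigroup on $X_0$. Let $\mathcal A=A_{\mathrm d}+A_{\mathrm{rc}}$ with linear operators satisfying $D(A_{\mathrm d})=D(\mathcal A)\subseteq D(A_{\mathrm{rc}})$, where $A_{\mathrm{rc}}$ is relatively bounded with respect to $A_{\mathrm d}$, i.e. $\|A_{\mathrm{rc}}x\|\le\alpha\|x\|+\beta\|A_{\mathrm d}x\|$ for all $x\in D(A_{\mathrm d})$ and some constants $\alpha,\beta\ge 0$. Let $\eta\ge 0$ with $\eta\in\rho(A_0)$, and let $E\in\mathcal L(U,X_0)$ satisfy $\mathcal R(E)\subset D(\mathcal A)$, $A_{\mathrm d}Eu=\eta Eu$ and $\mathcal B Eu=u$ for all $u\in U$; then $A_{\mathrm{rc}}E\in\mathcal L(U,X_0)$. On the Hilbert space $X=X_0\times U$ consider $$A=\begin{pmatrix}A_0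 & A_{\mathrm{rc}}E\\ 0&\eta I\end{pmatrix},\quad D(A)=D(A_0)\times U,\qquad B=\begin{pmatrix}-E\\ I\end{pmatrix}\in\mathcal L(U,X).$$ A pair $(S,Q)$, with $S$ an operator on a Hilbert space $Z$ and $Q\in\mathcal L(U,Z)$, is called exponentially stabilizable if there is $F\in\mathcal L(Z,U)$ such that $S+QF$, with domain $D(S)$, generates a strongly continuous semigroup $T(t)$ with $\|T(t)\|\le Me^{-\omega t}$ for all $t\ge 0$ and some constants $M,\omega>0$. Let $\sigma^+(A_0)=\sigma(A_0)\cap\{s\in\mathbb C:\operatorname{Re}s\ge 0\}$. Assume that $(A_0,E)$ is exponentially stabilizable. (i) If $A_{\mathrm{rc}}E=0$, then $(A,B)$ is exponentially stabilizable. (ii) If $A_{\mathrm{rc}}E\neq 0$ and $$\ker\big((sI-A_0)^*\big)\cap\ker\big((A_{\mathrm{rc}}E+(\eta-s)E)^*\big)=\{0\}\qquad\text{for all } s\in\sigma^+(A_0),$$ then $(A,B)$ is exponentially stabilizable. -/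

import Mathlib

open Filter Topology

noncomputable section

namespace BCS

/-! ## Strongly continuous semigroups, generators, exponential stabilizability -/

section Semigroups

variable {X : Type*} [NormedAddCommGroup X] [NormedSpace ℂ X]

/-- `(T t)_{t ≥ 0}` is a strongly continuous semigroup of bounded operators on `X`
(the values of `T` at negative times play no role). -/
structure IsC0Semigroup (T : ℝ → X →L[ℂ] X) : Prop where
  zero : T 0 = 1
  add : ∀ s t : ℝ, 0 ≤ s → 0 ≤ t → T (s + t) = T s * T t
  strongly_continuous : ∀ x : X, Tendsto (fun t : ℝ => T t x) (𝓝[>] 0) (𝓝 x)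

/-- `A` is the infinitesimal generator of `T`: one has `x ∈ D(A)` and `A x = y` if and only if
`(T t x - x) / t → y` as `t → 0+`. -/
def IsGenerator (A : X →ₗ.[ℂ] X) (T : ℝ → X →L[ℂ] X) : Prop :=
  ∀ x y : X, (x, y) ∈ A.graph ↔
    Tendsto (fun t : ℝ => ((t : ℂ)⁻¹) • (T t x - x)) (𝓝[>] 0) (𝓝 y)

/-- `‖T t‖ ≤ M e^{-ω t}` for all `t ≥ 0`, for some `M` and some `ω > 0`. -/
def IsExpStable (T : ℝ → X →L[ℂ] X) : Prop :=
  ∃ M ω : ℝ, 0 < ω ∧ ∀ t : ℝ, 0 ≤ t → ‖T t‖ ≤ M * Real.exp (-ω * t)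

/-- The pair `(A, B)`, with `B` bounded, is exponentially stabilizable: for some bounded feedback
`F`, the operator `A + B F` with domain `D(A)` generates an exponentially stable strongly
continuous semigroup. -/
def IsExpStabilizable {U : Type*} [NormedAddCommGroup U] [NormedSpace ℂ U]
    (A : X →ₗ.[ℂ] X) (B : U →L[ℂ] X) : Prop :=
  ∃ (F : X →L[ℂ] U) (T : ℝ → X →L[ℂ] X),
    IsC0Semigroup T ∧
    IsGenerator (((B.comp F : X →L[ℂ] X) : X →ₗ[ℂ] X) +ᵥ A) T ∧
    IsExpStable T

/-- The operator `s I - A` with domain `D(A)`. -/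
def shift (s : ℂ) (A : X →ₗ.[ℂ] X) : X →ₗ.[ℂ] X :=
  (s • (LinearMap.id : X →ₗ[ℂ] X)) +ᵥ (-A)

/-- `ρ(A)`: those `s` for which `s I - A : D(A) → X` has a bounded everywhere defined inverse. -/
def resolventSet (A : X →ₗ.[ℂ] X) : Set ℂ :=
  {s | ∃ R : X →L[ℂ] X, ∀ x y : X, (x, y) ∈ (shift s A).graph ↔ R y = x}

/-- `σ(A) = ℂ \ ρ(A)`. -/
def spec (A : X →ₗ.[ℂ] X) : Set ℂ := (resolventSet A)ᶜ

/-- `σ⁺(A)`: the part of the spectrum in the closed right half-plane. -/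
def specPlus (A : X →ₗ.[ℂ] X) : Set ℂ := spec A ∩ closure {s : ℂ | 0 < s.re}

/-- The kernel `{x ∈ D(A) | A x = 0}` of a partially defined operator. -/
def kernel {Y : Type*} [NormedAddCommGroup Y] [NormedSpace ℂ Y] (A : X →ₗ.[ℂ] Y) :
    Submodule ℂ X :=
  A.graph.comap (LinearMap.inl ℂ X Y)

end Semigroups

/-! ## Boundary control systems -/

section Systems

/-- The input space `ℂ^m`. -/
abbrev Inp (m : ℕ) : Type := EuclideanSpace ℂ (Fin m)

variable {X₀ : Type*} [NormedAddCommGroup X₀] [InnerProductSpace ℂ X₀] {m : ℕ}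

/-- The restriction `A₀` of `𝒜` to `D(A₀) = D(𝒜) ∩ ker 𝓑`. -/
def homPart (𝒜 : X₀ →ₗ.[ℂ] X₀) (𝓑 : 𝒜.domain →ₗ[ℂ] Inp m) : X₀ →ₗ.[ℂ] X₀ :=
  𝒜.domRestrict ((LinearMap.ker 𝓑).map 𝒜.domain.subtype)

/-- `(𝒜, 𝓑)` is a boundary control system: `A₀` generates a strongly continuous semigroup and
the boundary operator `𝓑 : D(𝒜) → ℂ^m` is onto. -/
structure IsBoundaryControlSystem (𝒜 : X₀ →ₗ.[ℂ] X₀) (𝓑 : 𝒜.domain →ₗ[ℂ] Inp m) : Prop where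
  generates : ∃ T : ℝ → X₀ →L[ℂ] X₀, IsC0Semigroup T ∧ IsGenerator (homPart 𝒜 𝓑) T
  surjective : Function.Surjective 𝓑

/-- The decomposition `𝒜 = A_d + A_rc` with `D(A_d) = D(𝒜) ⊆ D(A_rc)` and `A_rc` relatively
bounded with respect to `A_d`. -/
structure IsDecomposition (𝒜 Ad Arc : X₀ →ₗ.[ℂ] X₀) : Prop where
  domain_eq : Ad.domain = 𝒜.domain
  domain_le : 𝒜.domain ≤ Arc.domain
  eq_add : 𝒜 = Ad + Arc
  relatively_bounded : ∃ α β : ℝ, 0 ≤ α ∧ 0 ≤ β ∧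
    ∀ (x : X₀) (hd : x ∈ Ad.domain) (hr : x ∈ Arc.domain),
      ‖Arc ⟨x, hr⟩‖ ≤ α * ‖x‖ + β * ‖Ad ⟨x, hd⟩‖

/-- `η ≥ 0` lies in `ρ(A₀)` and the bounded operator `E : ℂ^m → X₀` maps into `D(𝒜)`, with
`A_d E u = η E u` and `𝓑 E u = u`. -/
structure IsExtension (𝒜 : X₀ →ₗ.[ℂ] X₀) (𝓑 : 𝒜.domain →ₗ[ℂ] Inp m) (Ad : X₀ →ₗ.[ℂ] X₀)
    (η : ℝ) (E : Inp m →L[ℂ] X₀) : Prop where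
  nonneg : 0 ≤ η
  mem_resolventSet : (η : ℂ) ∈ resolventSet (homPart 𝒜 𝓑)
  mem_domain : ∀ u, E u ∈ 𝒜.domain
  eigen : ∀ u, (E u, (η : ℂ) • E u) ∈ Ad.graph
  boundary : ∀ u, 𝓑 ⟨E u, mem_domain u⟩ = u

/-- The operator `A E` on `ℂ^m`, for `E` with range in `D(A)`; it is bounded because `ℂ^m` is
finite-dimensional. -/
def compE (A : X₀ →ₗ.[ℂ] X₀) (E : Inp m →L[ℂ] X₀) (h : ∀ u, E u ∈ A.domain) :
    Inp m →L[ℂ] X₀ :=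
  LinearMap.toContinuousLinearMap (A.toFun.comp ((E : Inp m →ₗ[ℂ] X₀).codRestrict A.domain h))

/-- The state space `X = X₀ × ℂ^m` of the extended system, with the Hilbert space norm. -/
abbrev ExtState (X₀ : Type*) (m : ℕ) : Type _ := WithLp 2 (X₀ × Inp m)

/-- The extended operator `A = [[A₀, G], [0, η I]]` with domain `D(A₀) × ℂ^m`. -/
def extA (A₀ : X₀ →ₗ.[ℂ] X₀) (G : Inp m →L[ℂ] X₀) (η : ℝ) :
    ExtState X₀ m →ₗ.[ℂ] ExtState X₀ m where
  domain := A₀.domain.comap (WithLp.fstₗ 2 ℂ X₀ (Inp m))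
  toFun := (WithLp.linearEquiv 2 ℂ (X₀ × Inp m)).symm.toLinearMap ∘ₗ
    LinearMap.prod
      (A₀.toFun ∘ₗ (WithLp.fstₗ 2 ℂ X₀ (Inp m)).submoduleComap A₀.domain +
        (G : Inp m →ₗ[ℂ] X₀) ∘ₗ WithLp.sndₗ 2 ℂ X₀ (Inp m) ∘ₗ Submodule.subtype _)
      ((η : ℂ) • (WithLp.sndₗ 2 ℂ X₀ (Inp m) ∘ₗ Submodule.subtype _))

theorem extA_apply (A₀ : X₀ →ₗ.[ℂ] X₀) (G : Inp m →L[ℂ] X₀) (η : ℝ)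
    (v : X₀) (u : Inp m) (hv : v ∈ A₀.domain) :
    extA A₀ G η ⟨WithLp.toLp 2 (v, u), hv⟩ =
      WithLp.toLp 2 (A₀ ⟨v, hv⟩ + G u, (η : ℂ) • u) := rfl

/-- The extended input operator `B κ = (-E κ, κ)`. -/
def extB (E : Inp m →L[ℂ] X₀) : Inp m →L[ℂ] ExtState X₀ m :=
  ((WithLp.prodContinuousLinearEquiv 2 ℂ X₀ (Inp m)).symm :
      (X₀ × Inp m) →L[ℂ] ExtState X₀ m).comp
    ((-E).prod (ContinuousLinearMap.id ℂ (Inp m)))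

theorem extB_apply (E : Inp m →L[ℂ] X₀) (κ : Inp m) :
    extB E κ = WithLp.toLp 2 (-E κ, κ) := rfl

end Systems

end BCS

end

/-!
The extended pair is shown to satisfy a Hautus test, and this test is shown to suffice.

*Structure of the unstable part.* Let `S` be the exponentially stable semigroup obtained from the
semigroup `T₀` of `A₀` by the feedback that stabilizes `(A₀, E)`. By Duhamel's formula
`S τ - T₀ τ` is an integral of operators `T₀(τ - r) E F S(r)`. As the input space is
finite-dimensional, this difference is of finite rank up to an arbitrarily small error, so for large
`τ` the operator `T₀ τ` is a strict contraction plus an operator of finite rank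
(`isEssContraction_of_feedback`). The semigroup `T` of the extended operator has the same property,
since it differs from `T₀ ⊕ 1` by an explicit finite-rank convolution term. For such an operator `L`
the Fredholm alternative and Gelfand's formula show that `L` is power stable unless `L^*` has an
eigenvalue of modulus at least one (`IsEssContraction.exists_norm_pow_lt_one`), and Bessel's
inequality bounds the dimension of the unstable generalized eigenspaces of `L^*`
(`IsEssContraction.exists_flag_bound`).

*Moving one eigenvalue at a time.* If `T` is not stable, the eigenspace of `(T τ)^*` for an unstable
eigenvalue is finite-dimensional and invariant under all `(T t)^*`, so it contains a common
eigenvector `φ`, with `⟪φ, T t x⟫ = e^{st} ⟪φ, x⟫` and `Re s ≥ 0`. By the Hautus test some input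
`u` satisfies `⟪φ, B u⟫ = -1 - s`. The feedback `x ↦ ⟪φ, x⟫ u` moves the eigenvalue `s` to `-1`, and
its closed loop is the explicit semigroup `T t x + ⟪φ, x⟫ ∫₀ᵗ e^{-(t - r)} T r B u dr`
(`IsC0Semigroup.perturb`), so no general perturbation theory is needed. The Hautus test survives the
feedback, and adding `φ` to an unstable chain of the new semigroup gives a longer one for the old
semigroup (`UnstableFlag.sup_span_singleton`). The bound on the length of such chains therefore
drops, and induction finishes the proof (`isExpStabilizable_of_flag_bound`).

*The Hautus test.* A left eigenvector `(p, w)` of the extended operator that is invisible through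
the input operator has `w = E^* p`, and `p` is annihilated by `(s - A₀)^*` and
`(A_rc E + (η - s) E)^*`. In case (ii) this is excluded by hypothesis. In case (i) the second
condition reads `E^* p = 0`, because `η` is in the resolvent set and `s` is not, and then
stabilizability of `(A₀, E)` gives `p = 0` (`IsExpStabilizable.eq_zero_of_eigenfunctional`).
-/

namespace BCS

open MeasureTheory Set

/-! ### Strongly continuous semigroups -/

section

variable {X : Type*} [NormedAddCommGroup X] [NormedSpace ℂ X]

theorem mem_graph_vadd_iff (P : X →ₗ[ℂ] X) (A : X →ₗ.[ℂ] X) (x y : X) :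
    (x, y) ∈ (P +ᵥ A).graph ↔ (x, y - P x) ∈ A.graph := by
  simp only [LinearPMap.mem_graph_iff, Subtype.exists, LinearPMap.vadd_domain, exists_and_left,
    exists_eq_left]
  refine exists_congr fun h => ?_
  rw [LinearPMap.vadd_apply, eq_sub_iff_add_eq, add_comm]

theorem mem_graph_shift_iff (A : X →ₗ.[ℂ] X) (s : ℂ) (x y : X) :
    (x, y) ∈ (shift s A).graph ↔ (x, s • x - y) ∈ A.graph := by
  rw [shift, mem_graph_vadd_iff]
  simp only [LinearPMap.mem_graph_iff, Subtype.exists, LinearPMap.neg_domain, exists_and_left,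
    exists_eq_left]
  refine exists_congr fun h => ?_
  rw [LinearPMap.neg_apply, neg_eq_iff_eq_neg]
  simp

namespace IsC0Semigroup

variable {T : ℝ → X →L[ℂ] X}

theorem add_apply (hT : IsC0Semigroup T) {s t : ℝ} (hs : 0 ≤ s) (ht : 0 ≤ t) (x : X) :
    T (s + t) x = T s (T t x) := by
  rw [hT.add s t hs ht]; rfl

theorem commute (hT : IsC0Semigroup T) {s t : ℝ} (hs : 0 ≤ s) (ht : 0 ≤ t) :
    T s * T t = T t * T s := by
  rw [← hT.add s t hs ht, ← hT.add t s ht hs, add_comm]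

theorem map_nat_mul (hT : IsC0Semigroup T) {τ : ℝ} (hτ : 0 ≤ τ) (n : ℕ) :
    T (n * τ) = T τ ^ n := by
  induction n with
  | zero => simp [hT.zero]
  | succ n ih =>
    rw [Nat.cast_succ, add_mul, one_mul, hT.add _ _ (by positivity) hτ, ih, pow_succ]

variable {A : X →ₗ.[ℂ] X}

theorem graph_invariant (hT : IsC0Semigroup T) (hA : IsGenerator A T) {t : ℝ} (ht : 0 ≤ t)
    {x y : X} (h : (x, y) ∈ A.graph) : (T t x, T t y) ∈ A.graph := by
  rw [hA] at h ⊢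
  refine (((T t).continuous.tendsto y).comp h).congr' ?_
  filter_upwards [self_mem_nhdsWithin] with r hr
  have hr : 0 ≤ r := le_of_lt hr
  simp only [Function.comp_apply, map_smul, map_sub]
  rw [← hT.add_apply ht hr, ← hT.add_apply hr ht, add_comm]

theorem hasDerivWithinAt_orbit (hT : IsC0Semigroup T) (hA : IsGenerator A T) {t : ℝ} (ht : 0 ≤ t)
    {x y : X} (h : (x, y) ∈ A.graph) :
    HasDerivWithinAt (fun r => T (max r 0) x) (T t y) (Ici t) t := by
  rw [hasDerivWithinAt_iff_tendsto_slope, Ici_sdiff_left]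
  have h1 := (hA _ _).1 (hT.graph_invariant hA ht h)
  have h2 : Tendsto (fun r : ℝ => r - t) (𝓝[>] t) (𝓝[>] 0) := by
    refine tendsto_nhdsWithin_iff.2 ⟨?_, ?_⟩
    · have : Continuous fun r : ℝ => r - t := by fun_prop
      simpa using (this.tendsto t).mono_left nhdsWithin_le_nhds
    · filter_upwards [self_mem_nhdsWithin] with r hr
      simpa using hr
  refine (h1.comp h2).congr' ?_
  filter_upwards [self_mem_nhdsWithin] with r hr
  have hr : t < r := hr
  simp only [Function.comp_apply, slope_def_module]
  rw [← hT.add_apply (by linarith) ht, sub_add_cancel, max_eq_left ht, max_eq_left (by linarith),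
    ← Complex.ofReal_inv, Complex.coe_smul]

variable [CompleteSpace X]

/-- Otherwise `‖T (t n)‖ → ∞` along some `t n → 0`, against the uniform boundedness principle. -/
theorem exists_bound_near_zero (hT : IsC0Semigroup T) :
    ∃ δ > 0, ∃ M ≥ 1, ∀ t ∈ Icc (0 : ℝ) δ, ‖T t‖ ≤ M := by
  by_contra! H
  have H' : ∀ n : ℕ, ∃ t ∈ Icc (0 : ℝ) (1 / ((n : ℝ) + 1)), (n : ℝ) + 1 < ‖T t‖ := fun n => by
    exact H _ (by positivity) _ (by linarith [(Nat.cast_nonneg n : (0:ℝ) ≤ n)])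
  choose t ht hbig using H'
  have hpos : ∀ᶠ n in atTop, t n ∈ Ioi (0 : ℝ) := by
    obtain ⟨N, hN⟩ := exists_nat_gt ‖T 0‖
    filter_upwards [eventually_ge_atTop N] with n hn
    refine lt_of_le_of_ne (ht n).1 fun h => ?_
    have h1 := hbig n
    rw [← h] at h1
    have : (N : ℝ) ≤ n := by exact_mod_cast hn
    linarith
  have ht0 : Tendsto t atTop (𝓝[>] 0) := by
    refine tendsto_nhdsWithin_iff.2 ⟨?_, hpos⟩
    exact squeeze_zero (fun n => (ht n).1) (fun n => (ht n).2)
      tendsto_one_div_add_atTop_nhds_zero_nat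
  obtain ⟨C, hC⟩ := banach_steinhaus (g := fun n => T (t n)) fun x => by
    have h1 := ((hT.strongly_continuous x).comp ht0).norm
    obtain ⟨C, hC⟩ := h1.bddAbove_range
    exact ⟨C, fun n => hC ⟨n, rfl⟩⟩
  obtain ⟨N, hN⟩ := exists_nat_gt C
  linarith [hC N, hbig N]

theorem exists_bound (hT : IsC0Semigroup T) (b : ℝ) :
    ∃ M ≥ 1, ∀ t ∈ Icc (0 : ℝ) b, ‖T t‖ ≤ M := by
  obtain ⟨δ, hδ, M, hM, hb⟩ := hT.exists_bound_near_zero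
  have key : ∀ n : ℕ, ∀ t ∈ Icc (0 : ℝ) (n * δ), ‖T t‖ ≤ M ^ (n + 1) := by
    intro n
    induction n with
    | zero =>
      intro t ht
      simpa using hb t ⟨ht.1, by linarith [ht.2, show ((0 : ℕ) : ℝ) * δ = 0 by simp]⟩
    | succ n ih =>
      intro t ht
      rcases le_total t δ with h | h
      · exact (hb t ⟨ht.1, h⟩).trans (le_self_pow₀ hM (by simp))
      · have h2 : t - δ ∈ Icc (0 : ℝ) (n * δ) := by
          have := ht.2
          push_cast at this
          constructor <;> linarith
        have h3 : T t = T (t - δ) * T δ := by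
          rw [← hT.add _ _ h2.1 hδ.le, sub_add_cancel]
        rw [h3, pow_succ]
        exact (norm_mul_le _ _).trans (mul_le_mul (ih _ h2) (hb δ ⟨hδ.le, le_rfl⟩)
          (norm_nonneg _) (by positivity))
  obtain ⟨n, hn⟩ := exists_nat_gt (b / δ)
  rw [div_lt_iff₀ hδ] at hn
  exact ⟨M ^ (n + 1), one_le_pow₀ hM, fun t ht => key n t ⟨ht.1, ht.2.trans hn.le⟩⟩

/-- The orbit `t ↦ T t x`, frozen at `x` for negative times, is continuous on the whole line. -/
theorem continuous_orbit (hT : IsC0Semigroup T) (x : X) :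
    Continuous fun t : ℝ => T (max t 0) x := by
  rw [continuous_iff_continuousAt]
  intro t₀
  obtain ⟨M, hM, hb⟩ := hT.exists_bound (|t₀| + 1)
  have hz : Tendsto (fun h : ℝ => T h x - x) (𝓝[≥] 0) (𝓝 0) := by
    rw [← Ioi_insert, nhdsWithin_insert, tendsto_sup]
    refine ⟨tendsto_pure_left.2 fun s hs => ?_, ?_⟩
    · simpa [hT.zero] using mem_of_mem_nhds hs
    · simpa using (hT.strongly_continuous x).sub_const x
  have habs : Tendsto (fun t : ℝ => |max t 0 - max t₀ 0|) (𝓝 t₀) (𝓝[≥] 0) := by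
    refine tendsto_nhdsWithin_iff.2 ⟨?_, Eventually.of_forall fun t => mem_Ici.2 (abs_nonneg _)⟩
    have : Continuous fun t : ℝ => |max t 0 - max t₀ 0| := by fun_prop
    simpa using this.tendsto t₀
  rw [ContinuousAt, tendsto_iff_norm_sub_tendsto_zero]
  refine squeeze_zero' (Eventually.of_forall fun _ => norm_nonneg _) ?_
    (by simpa using ((hz.comp habs).norm.const_mul M))
  have hnear : ∀ᶠ t in 𝓝 t₀, |t - t₀| < 1 := by
    filter_upwards [Metric.ball_mem_nhds t₀ one_pos] with t ht using by
      simpa [Real.dist_eq] using ht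
  filter_upwards [hnear] with t ht
  have key : ∀ a b : ℝ, 0 ≤ a → a ≤ b → a ≤ |t₀| + 1 → ‖T b x - T a x‖ ≤
      M * ‖T (b - a) x - x‖ := by
    intro a b ha hab hab'
    have : T b x - T a x = T a (T (b - a) x - x) := by
      rw [map_sub, ← hT.add_apply ha (by linarith), add_sub_cancel]
    rw [this]
    exact (T a).le_of_opNorm_le (hb a ⟨ha, hab'⟩) _
  have h1 := abs_lt.1 ht
  have h2 := le_abs_self t₀
  have h3 := abs_nonneg t₀
  rcases le_total (max t 0) (max t₀ 0) with h | h
  · rw [abs_of_nonpos (by linarith), neg_sub, norm_sub_rev]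
    exact key _ _ (le_max_right _ _) h (max_le (by linarith) (by linarith))
  · rw [abs_of_nonneg (by linarith)]
    exact key _ _ (le_max_right _ _) h (max_le (by linarith) (by linarith))

/-- Joint continuity of `(t, x) ↦ T t x` on `[0, ∞) × X`. -/
theorem tendsto_apply (hT : IsC0Semigroup T) {ι : Type*} {l : Filter ι} {f : ι → ℝ} {g : ι → X}
    {t : ℝ} {x : X} (ht : 0 ≤ t) (hf0 : ∀ᶠ i in l, 0 ≤ f i) (hf : Tendsto f l (𝓝 t))
    (hg : Tendsto g l (𝓝 x)) : Tendsto (fun i => T (f i) (g i)) l (𝓝 (T t x)) := by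
  obtain ⟨M, hM, hb⟩ := hT.exists_bound (t + 1)
  have h1 : Tendsto (fun i => T (f i) x) l (𝓝 (T t x)) := by
    have := ((hT.continuous_orbit x).tendsto t).comp hf
    rw [max_eq_left ht] at this
    refine this.congr' ?_
    filter_upwards [hf0] with i hi
    simp [hi]
  have h2 : Tendsto (fun i => T (f i) (g i - x)) l (𝓝 0) := by
    rw [tendsto_zero_iff_norm_tendsto_zero]
    refine squeeze_zero' (Eventually.of_forall fun _ => norm_nonneg _) ?_
      (by simpa using ((tendsto_iff_norm_sub_tendsto_zero.1 hg).const_mul M))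
    filter_upwards [hf0, hf.eventually (gt_mem_nhds (lt_add_one t))] with i hi hi'
    exact (T (f i)).le_of_opNorm_le (hb _ ⟨hi, hi'.le⟩) _
  simpa using h2.add h1

/-- An eigenfunctional of the generator is an eigenfunctional of the semigroup, once the domain is
known to be dense. -/
theorem functional_apply (hT : IsC0Semigroup T) (hA : IsGenerator A T)
    (hd : Dense (A.domain : Set X)) {φ : X →L[ℂ] ℂ} {s : ℂ}
    (h : ∀ x y, (x, y) ∈ A.graph → φ y = s * φ x) {t : ℝ} (ht : 0 ≤ t) (x : X) :
    φ (T t x) = Complex.exp (s * t) * φ x := by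
  revert x
  rw [← funext_iff]
  refine Continuous.ext_on hd (by fun_prop) (by fun_prop) fun x hx => ?_
  obtain ⟨y, hxy⟩ := LinearPMap.mem_domain_iff.1 hx
  have hcont : Continuous fun r : ℝ => Complex.exp (-(s * r)) * φ (T (max r 0) x) := by
    have := φ.continuous.comp (hT.continuous_orbit x)
    exact (by fun_prop : Continuous fun r : ℝ => Complex.exp (-(s * r))).mul this
  have hconst := constant_of_has_deriv_right_zero (a := 0) (b := t) hcont.continuousOn
    (fun r hr => by
      have h1 : HasDerivWithinAt (fun r => φ (T (max r 0) x)) (φ (T r y)) (Ici r) r :=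
        (φ.restrictScalars ℝ).hasFDerivAt.comp_hasDerivWithinAt r
          (hT.hasDerivWithinAt_orbit hA hr.1 hxy)
      have h2 : HasDerivWithinAt (fun r : ℝ => Complex.exp (-(s * r)))
          (Complex.exp (-(s * r)) * (-(s * 1))) (Ici r) r :=
        (((Complex.ofRealCLM.hasDerivAt (x := r)).const_mul s).neg.cexp).hasDerivWithinAt
      convert! h2.mul h1 using 1
      rw [h _ _ (hT.graph_invariant hA hr.1 hxy), max_eq_left hr.1]
      ring) t ⟨ht, le_rfl⟩
  simp only [max_eq_left ht, max_self, hT.zero, Complex.ofReal_zero, mul_zero, neg_zero,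
    Complex.exp_zero, one_mul, one_apply_eq_self] at hconst
  rw [← hconst, ← mul_assoc, ← Complex.exp_add]
  simp

end IsC0Semigroup

end

/-! ### Convolution with an exponential and explicit perturbations -/

section

variable {X : Type*} [NormedAddCommGroup X] [NormedSpace ℂ X]

namespace IsC0Semigroup

variable {T : ℝ → X →L[ℂ] X} {A : X →ₗ.[ℂ] X} [CompleteSpace X]

theorem continuous_exp_smul_orbit (hT : IsC0Semigroup T) (q : ℂ) (t : ℝ) (x : X) :
    Continuous fun r : ℝ => Complex.exp (q * (t - r)) • T (max r 0) x :=
  (by fun_prop : Continuous fun r : ℝ => Complex.exp (q * (t - r))).smul (hT.continuous_orbit x)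

/-- The convolution `x ↦ ∫₀ᵗ e^{q (t - r)} T r x dr` of the semigroup with an exponential, as a
bounded operator. The orbit is frozen at negative times, where `T` carries no information; for
`t ≥ 0` this does not matter. -/
noncomputable def expConv (hT : IsC0Semigroup T) (q : ℂ) (t : ℝ) : X →L[ℂ] X :=
  LinearMap.mkContinuousOfExistsBound
    { toFun := fun x => ∫ r in (0 : ℝ)..t, Complex.exp (q * (t - r)) • T (max r 0) x
      map_add' := fun x y => by
        rw [← intervalIntegral.integral_add
          ((hT.continuous_exp_smul_orbit q t x).intervalIntegrable _ _)
          ((hT.continuous_exp_smul_orbit q t y).intervalIntegrable _ _)]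
        simp
      map_smul' := fun c x => by
        rw [RingHom.id_apply, ← intervalIntegral.integral_smul]
        simp only [map_smul, smul_comm c] }
    (by
      obtain ⟨M, hM, hb⟩ := hT.exists_bound |t|
      refine ⟨Real.exp (‖q‖ * |t|) * M * |t|, fun x => ?_⟩
      have hint : ∀ r ∈ uIoc 0 t, ‖Complex.exp (q * (t - r)) • T (max r 0) x‖ ≤
          Real.exp (‖q‖ * |t|) * M * ‖x‖ := fun r hr => by
        have h1 : |t - r| ≤ |t| ∧ |r| ≤ |t| := by
          rcases mem_uIoc.1 hr with h | h
          · rw [abs_of_nonneg (by linarith : 0 ≤ t), abs_of_nonneg (by linarith : 0 ≤ r),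
              abs_of_nonneg (by linarith)]
            constructor <;> linarith
          · rw [abs_of_neg (by linarith : t < 0), abs_of_nonpos (by linarith : r ≤ 0),
              abs_of_nonpos (by linarith)]
            constructor <;> linarith
        have h2 : ‖Complex.exp (q * (t - r))‖ ≤ Real.exp (‖q‖ * |t|) := by
          refine (Complex.norm_exp_le_exp_norm _).trans (Real.exp_le_exp.2 ?_)
          rw [norm_mul, ← Complex.ofReal_sub, Complex.norm_real]
          exact mul_le_mul_of_nonneg_left h1.1 (norm_nonneg q)
        rw [norm_smul, mul_assoc]
        exact mul_le_mul h2 ((T (max r 0)).le_of_opNorm_le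
          (hb _ ⟨le_max_right _ _, max_le ((le_abs_self r).trans h1.2) (abs_nonneg t)⟩) x)
          (norm_nonneg _) (Real.exp_nonneg _)
      refine (intervalIntegral.norm_integral_le_of_norm_le_const hint).trans (le_of_eq ?_)
      rw [sub_zero]
      ring)

theorem expConv_apply (hT : IsC0Semigroup T) (q : ℂ) (t : ℝ) (x : X) :
    hT.expConv q t x = ∫ r in (0 : ℝ)..t, Complex.exp (q * (t - r)) • T (max r 0) x := rfl

theorem expConv_zero (hT : IsC0Semigroup T) (q : ℂ) : hT.expConv q 0 = 0 := by
  ext x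
  simp [expConv_apply]

theorem expConv_add (hT : IsC0Semigroup T) (q : ℂ) {t h : ℝ} (ht : 0 ≤ t) (hh : 0 ≤ h) (x : X) :
    hT.expConv q (t + h) x =
      Complex.exp (q * h) • hT.expConv q t x + T t (hT.expConv q h x) := by
  have hc := fun t => hT.continuous_exp_smul_orbit q t x
  rw [expConv_apply, ← intervalIntegral.integral_add_adjacent_intervals
    ((hc _).intervalIntegrable 0 t) ((hc _).intervalIntegrable t _), expConv_apply, expConv_apply,
    ← intervalIntegral.integral_smul, ← (T t).intervalIntegral_comp_comm
      ((hc _).intervalIntegrable 0 h)]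
  congr 1
  · refine intervalIntegral.integral_congr fun r _ => ?_
    rw [smul_smul, ← Complex.exp_add]
    push_cast
    ring_nf
  · have := intervalIntegral.integral_comp_add_right (a := 0) (b := h)
      (fun r : ℝ => Complex.exp (q * (↑(t + h) - r)) • T (max r 0) x) t
    rw [zero_add, add_comm h t] at this
    rw [← this]
    refine intervalIntegral.integral_congr fun r hr => ?_
    rw [uIcc_of_le hh] at hr
    rw [map_smul, max_eq_left hr.1, max_eq_left (by linarith [hr.1]), ← hT.add_apply ht hr.1,
      add_comm r t]
    push_cast
    ring_nf

theorem tendsto_expConv (hT : IsC0Semigroup T) (q : ℂ) (x : X) :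
    Tendsto (fun h : ℝ => ((h : ℂ)⁻¹) • hT.expConv q h x) (𝓝[>] 0) (𝓝 x) := by
  have hc : Continuous fun r : ℝ => Complex.exp (-(q * r)) • T (max r 0) x :=
    (by fun_prop : Continuous fun r : ℝ => Complex.exp (-(q * r))).smul (hT.continuous_orbit x)
  have h1 := (hc.integral_hasStrictDerivAt 0 0).hasDerivAt.tendsto_slope_zero_right
  simp only [zero_add, intervalIntegral.integral_same, sub_zero, Complex.ofReal_zero, mul_zero,
    neg_zero, Complex.exp_zero, one_smul, max_self, hT.zero, one_apply_eq_self] at h1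
  have h2 : Tendsto (fun h : ℝ => Complex.exp (q * h)) (𝓝[>] 0) (𝓝 1) := by
    have : Continuous fun h : ℝ => Complex.exp (q * h) := by fun_prop
    simpa using (this.tendsto 0).mono_left nhdsWithin_le_nhds
  refine (by simpa using h2.smul h1 : Tendsto _ _ (𝓝 x)).congr fun h => ?_
  rw [expConv_apply, smul_comm, ← Complex.coe_smul, Complex.ofReal_inv,
    ← intervalIntegral.integral_smul]
  congr 1
  refine intervalIntegral.integral_congr fun r _ => ?_
  rw [smul_smul, ← Complex.exp_add]
  ring_nf

theorem dense_domain (hT : IsC0Semigroup T) (hA : IsGenerator A T) :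
    Dense (A.domain : Set X) := by
  intro x
  have hmem : ∀ t : ℝ, 0 ≤ t → hT.expConv 0 t x ∈ A.domain := fun t ht => by
    rw [LinearPMap.mem_domain_iff]
    refine ⟨T t x - x, (hA _ _).2 ?_⟩
    have h1 := hT.tendsto_expConv 0 x
    refine ((((T t).continuous.tendsto x).comp h1).sub h1).congr' ?_
    filter_upwards [self_mem_nhdsWithin] with h hh
    have hh : 0 ≤ h := le_of_lt hh
    -- Both sides are `V (t + h) x`, split at `t` or at `h`, where `V` is the convolution.
    have e1 := hT.expConv_add 0 ht hh x
    rw [add_comm, hT.expConv_add 0 hh ht x] at e1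
    simp only [zero_mul, Complex.exp_zero, one_smul] at e1
    simp only [Function.comp_apply, map_smul, ← smul_sub]
    congr 1
    rw [sub_eq_sub_iff_add_eq_add, add_comm, ← e1, add_comm]
  refine mem_closure_of_tendsto (hT.tendsto_expConv 0 x) ?_
  filter_upwards [self_mem_nhdsWithin] with h hh
  exact A.domain.smul_mem _ (hmem h (le_of_lt hh))

/-- If `P T(t) = e^{st} P`, then `P` turns the convolution into a scalar one. The second conjunct
is stated without division because `q = s` is allowed. -/
theorem comp_expConv (hT : IsC0Semigroup T) {P : X →L[ℂ] X} {s : ℂ}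
    (hP : ∀ t, 0 ≤ t → ∀ x, P (T t x) = Complex.exp (s * t) • P x) (q : ℂ) {t : ℝ} (ht : 0 ≤ t) :
    ∃ k : ℂ, (∀ x, P (hT.expConv q t x) = k • P x) ∧
      k * (q - s) = Complex.exp (q * t) - Complex.exp (s * t) := by
  refine ⟨∫ r in (0 : ℝ)..t, Complex.exp (q * (t - r) + s * r), fun x => ?_, ?_⟩
  · rw [expConv_apply, ← P.intervalIntegral_comp_comm
      ((hT.continuous_exp_smul_orbit q t x).intervalIntegrable 0 t),
      ← intervalIntegral.integral_smul_const]
    refine intervalIntegral.integral_congr fun r hr => ?_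
    rw [uIcc_of_le ht] at hr
    rw [map_smul, max_eq_left hr.1, hP r hr.1, smul_smul, ← Complex.exp_add]
  · have hd : ∀ r : ℝ, HasDerivAt (fun r : ℝ => -Complex.exp (q * (t - r) + s * r))
        (Complex.exp (q * (t - r) + s * r) * (q - s)) r := fun r => by
      have h0 : HasDerivAt (fun r : ℝ => (r : ℂ)) 1 r := Complex.ofRealCLM.hasDerivAt
      convert! (((h0.const_sub (t : ℂ)).const_mul q).add (h0.const_mul s)).cexp.neg using 1
      simp only [Pi.add_apply]
      ring
    rw [← intervalIntegral.integral_mul_const,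
      intervalIntegral.integral_eq_sub_of_hasDerivAt (fun r _ => hd r)
        (Continuous.intervalIntegrable (by fun_prop) _ _)]
    simp
    ring

/-- The operators `T(t) + ∫₀ᵗ e^{q(t-r)} T(r) P dr`. If `P T(t) = e^{st} P` and `P² = (q - s) P`,
they form the semigroup generated by `A + P`: then `P x(t)` solves the scalar equation `y' = q y`,
and variation of constants is an explicit formula. -/
noncomputable def perturb (hT : IsC0Semigroup T) (P : X →L[ℂ] X) (q : ℂ) (t : ℝ) : X →L[ℂ] X :=
  T t + (hT.expConv q t).comp P

theorem perturb_apply (hT : IsC0Semigroup T) (P : X →L[ℂ] X) (q : ℂ) (t : ℝ) (x : X) :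
    hT.perturb P q t x = T t x + hT.expConv q t (P x) := rfl

section Perturb

variable {P : X →L[ℂ] X} {s q : ℂ}

theorem comp_perturb (hT : IsC0Semigroup T)
    (hP : ∀ t, 0 ≤ t → ∀ x, P (T t x) = Complex.exp (s * t) • P x)
    (hPP : ∀ x, P (P x) = (q - s) • P x) {t : ℝ} (ht : 0 ≤ t) (x : X) :
    P (hT.perturb P q t x) = Complex.exp (q * t) • P x := by
  obtain ⟨k, hk, hk'⟩ := hT.comp_expConv hP q ht
  rw [perturb_apply, map_add, hP t ht, hk, hPP, smul_smul, hk', ← add_smul, add_sub_cancel]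

theorem isC0Semigroup_perturb (hT : IsC0Semigroup T)
    (hP : ∀ t, 0 ≤ t → ∀ x, P (T t x) = Complex.exp (s * t) • P x)
    (hPP : ∀ x, P (P x) = (q - s) • P x) : IsC0Semigroup (hT.perturb P q) where
  zero := by
    ext x
    simp [perturb_apply, hT.expConv_zero, hT.zero]
  add t h ht hh := by
    ext x
    change _ = hT.perturb P q t (hT.perturb P q h x)
    rw [hT.perturb_apply P q t, hT.comp_perturb hP hPP hh, perturb_apply, perturb_apply,
      hT.add_apply ht hh, hT.expConv_add q ht hh, map_add, map_smul]
    abel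
  strongly_continuous x := by
    have h1 : Tendsto (fun h : ℝ => (h : ℂ) • ((h : ℂ)⁻¹ • hT.expConv q h (P x))) (𝓝[>] 0)
        (𝓝 ((0 : ℂ) • P x)) := by
      refine Tendsto.smul ?_ (hT.tendsto_expConv q (P x))
      simpa using (Complex.continuous_ofReal.tendsto 0).mono_left nhdsWithin_le_nhds
    have h2 : Tendsto (fun h : ℝ => hT.expConv q h (P x)) (𝓝[>] 0) (𝓝 0) := by
      rw [zero_smul] at h1
      refine h1.congr' ?_
      filter_upwards [self_mem_nhdsWithin] with h hh
      rw [smul_inv_smul₀ (Complex.ofReal_ne_zero.2 (ne_of_gt hh))]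
    simpa [perturb_apply] using (hT.strongly_continuous x).add h2

theorem isGenerator_perturb (hT : IsC0Semigroup T) (hA : IsGenerator A T) :
    IsGenerator ((P : X →ₗ[ℂ] X) +ᵥ A) (hT.perturb P q) := by
  intro x y
  rw [mem_graph_vadd_iff, hA]
  have h1 := hT.tendsto_expConv q (P x)
  constructor
  · intro h
    refine (by simpa using h.add h1 : Tendsto _ _ (𝓝 y)).congr fun t => ?_
    rw [perturb_apply, ← smul_add]
    congr 1
    abel
  · intro h
    refine (h.sub h1).congr fun t => ?_
    rw [perturb_apply, ← smul_sub]
    congr 1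
    abel

end Perturb

end IsC0Semigroup

end

/-! ### Exponential stability and contractions up to finite rank -/

section

section ExpStable

variable {X : Type*} [NormedAddCommGroup X] [NormedSpace ℂ X]

theorem IsExpStable.tendsto_apply {T : ℝ → X →L[ℂ] X} (h : IsExpStable T) (x : X) :
    Tendsto (fun t => T t x) atTop (𝓝 0) := by
  obtain ⟨M, ω, hω, hb⟩ := h
  have h1 : Tendsto (fun t : ℝ => M * Real.exp (-ω * t) * ‖x‖) atTop (𝓝 0) := by
    have : Tendsto (fun t : ℝ => Real.exp (-ω * t)) atTop (𝓝 0) :=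
      Real.tendsto_exp_atBot.comp (tendsto_id.const_mul_atTop_of_neg (by linarith))
    simpa using (this.const_mul M).mul_const ‖x‖
  rw [tendsto_zero_iff_norm_tendsto_zero]
  refine squeeze_zero' (Eventually.of_forall fun _ => norm_nonneg _) ?_ h1
  filter_upwards [eventually_ge_atTop 0] with t ht
  exact (T t).le_of_opNorm_le (hb t ht) x

theorem IsExpStable.exists_norm_lt {T : ℝ → X →L[ℂ] X} (h : IsExpStable T) {ε : ℝ} (hε : 0 < ε) :
    ∃ τ > 0, ‖T τ‖ < ε := by
  obtain ⟨M, ω, hω, hb⟩ := h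
  have h1 : Tendsto (fun t : ℝ => M * Real.exp (-ω * t)) atTop (𝓝 0) := by
    have : Tendsto (fun t : ℝ => Real.exp (-ω * t)) atTop (𝓝 0) :=
      Real.tendsto_exp_atBot.comp (tendsto_id.const_mul_atTop_of_neg (by linarith))
    simpa using this.const_mul M
  obtain ⟨τ, h2, h3⟩ := ((h1.eventually (gt_mem_nhds hε)).and (eventually_gt_atTop 0)).exists
  exact ⟨τ, h3, (hb τ h3.le).trans_lt h2⟩

variable [CompleteSpace X]

theorem IsC0Semigroup.isExpStable_of_norm_lt_one {T : ℝ → X →L[ℂ] X} (hT : IsC0Semigroup T)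
    {a : ℝ} (ha : 0 < a) (h : ‖T a‖ < 1) : IsExpStable T := by
  obtain ⟨M, hM, hb⟩ := hT.exists_bound a
  set c := max ‖T a‖ (1 / 2) with hc
  have hc0 : 0 < c := lt_max_of_lt_right (by norm_num)
  have hc1 : c < 1 := max_lt h (by norm_num)
  have hlog : Real.log c < 0 := Real.log_neg hc0 hc1
  refine ⟨c⁻¹ * M, -Real.log c / a, div_pos (by linarith) ha, fun t ht => ?_⟩
  set k := ⌊t / a⌋₊ with hk
  have hk1 : k * a ≤ t := (le_div_iff₀ ha).1 (Nat.floor_le (by positivity))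
  have hk2 : t < (k + 1) * a := (div_lt_iff₀ ha).1 (Nat.lt_floor_add_one _)
  have h1 : T t = T a ^ k * T (t - k * a) := by
    rw [← hT.map_nat_mul ha.le, ← hT.add _ _ (by positivity) (by linarith)]
    congr 1
    ring
  have h2 : c ^ (k + 1) ≤ Real.exp (-(-Real.log c / a) * t) := by
    rw [← Real.exp_log (pow_pos hc0 (k + 1)), Real.exp_le_exp, Real.log_pow, neg_div, neg_neg,
      div_mul_eq_mul_div, le_div_iff₀ ha]
    push_cast
    nlinarith
  calc ‖T t‖ ≤ ‖T a ^ k‖ * ‖T (t - k * a)‖ := h1 ▸ norm_mul_le _ _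
    _ ≤ c ^ k * M := by
        refine mul_le_mul ?_ (hb _ ⟨by linarith, by linarith⟩) (norm_nonneg _) (by positivity)
        rcases Nat.eq_zero_or_pos k with h0 | h0
        · rw [h0, pow_zero, pow_zero]
          exact ContinuousLinearMap.norm_id_le
        · exact (norm_pow_le' _ h0).trans (pow_le_pow_left₀ (norm_nonneg _) (le_max_left _ _) _)
    _ = c⁻¹ * M * c ^ (k + 1) := by
        rw [pow_succ]
        field_simp
    _ ≤ _ := by gcongr

end ExpStable

section EssContraction

/-- A bounded operator that becomes a strict contraction after subtracting an operator of finite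
rank. Outside the open unit disc such an operator has only eigenvalues of finite multiplicity in
its spectrum. -/
def IsEssContraction {X : Type*} [NormedAddCommGroup X] [NormedSpace ℂ X] (L : X →L[ℂ] X) : Prop :=
  ∃ (C R : X →L[ℂ] X) (V : Submodule ℂ X), L = C + R ∧ ‖C‖ < 1 ∧
    FiniteDimensional ℂ V ∧ ∀ x, R x ∈ V

variable {X : Type*} [NormedAddCommGroup X]

section Normed

variable [NormedSpace ℂ X] {L : X →L[ℂ] X}

theorem IsEssContraction.add_finiteRank (hL : IsEssContraction L) {K : X →L[ℂ] X}
    {W : Submodule ℂ X} [FiniteDimensional ℂ W] (hK : ∀ x, K x ∈ W) : IsEssContraction (L + K) := by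
  obtain ⟨C, R, V, rfl, hC, hV, hR⟩ := hL
  exact ⟨C, R + K, V ⊔ W, by rw [add_assoc], hC, inferInstance,
    fun x => Submodule.add_mem_sup (hR x) (hK x)⟩

theorem isCompactOperator_of_mem {R : X →L[ℂ] X} {V : Submodule ℂ X} [FiniteDimensional ℂ V]
    (hR : ∀ x, R x ∈ V) : IsCompactOperator R :=
  haveI : ProperSpace V := FiniteDimensional.proper ℂ V
  (isCompactOperator_of_locallyCompactSpace_dom (R.codRestrict V hR)).clm_comp V.subtypeL

variable [CompleteSpace X]

theorem isUnit_sub_of_norm_lt {C : X →L[ℂ] X} {μ : ℂ} (h : ‖C‖ < ‖μ‖) :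
    IsUnit (algebraMap ℂ (X →L[ℂ] X) μ - C) := by
  refine spectrum.mem_resolventSet_of_norm_lt_mul (lt_of_le_of_lt ?_ h)
  exact mul_le_of_le_one_right (norm_nonneg _) ContinuousLinearMap.norm_id_le

/-- Fredholm alternative: `μ - C` is invertible, and `μ - L = (μ - C) (1 - (μ - C)⁻¹ R)`. -/
theorem IsEssContraction.exists_eigenvector (hL : IsEssContraction L) {μ : ℂ} (hμ : 1 ≤ ‖μ‖)
    (h : μ ∈ spectrum ℂ L) : ∃ x ≠ 0, L x = μ • x := by
  obtain ⟨C, R, V, rfl, hC, hV, hR⟩ := hL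
  obtain ⟨u, hu⟩ := isUnit_sub_of_norm_lt (hC.trans_le hμ)
  have hcomp : IsCompactOperator ((↑u⁻¹ : X →L[ℂ] X) * R) :=
    (isCompactOperator_of_mem hR).clm_comp _
  rcases hcomp.hasEigenvalue_or_mem_resolventSet one_ne_zero with h1 | h1
  · obtain ⟨x, hx⟩ := h1.exists_hasEigenvector
    refine ⟨x, hx.2, ?_⟩
    have h2 : (↑u⁻¹ : X →L[ℂ] X) (R x) = x := by simpa using hx.apply_eq_smul
    have h3 : (u : X →L[ℂ] X) x = R x := by
      conv_lhs => rw [← h2]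
      change ((u : X →L[ℂ] X) * (↑u⁻¹ : X →L[ℂ] X)) (R x) = R x
      rw [Units.mul_inv, one_apply_eq_self]
    rw [hu] at h3
    have h4 : μ • x - C x = R x := by simpa [Algebra.algebraMap_eq_smul_one] using h3
    rw [_root_.add_apply, ← h4, add_sub_cancel]
  · refine absurd ?_ h
    have h2 : algebraMap ℂ (X →L[ℂ] X) μ - (C + R) =
        u * (algebraMap ℂ (X →L[ℂ] X) 1 - (↑u⁻¹ : X →L[ℂ] X) * R) := by
      rw [mul_sub, ← mul_assoc, Units.mul_inv, map_one, one_mul, mul_one, hu]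
      abel
    change IsUnit _
    rw [h2]
    exact u.isUnit.mul h1

theorem IsEssContraction.finiteDimensional_eigenspace (hL : IsEssContraction L) {μ : ℂ}
    (hμ : 1 ≤ ‖μ‖) :
    FiniteDimensional ℂ (LinearMap.ker ((L - algebraMap ℂ (X →L[ℂ] X) μ : X →L[ℂ] X) :
      X →ₗ[ℂ] X)) := by
  obtain ⟨C, R, V, rfl, hC, hV, hR⟩ := hL
  obtain ⟨u, hu⟩ := isUnit_sub_of_norm_lt (hC.trans_le hμ)
  refine Submodule.finiteDimensional_of_le
    (S₂ := V.map ((↑u⁻¹ : X →L[ℂ] X) : X →ₗ[ℂ] X)) fun x hx => ⟨R x, hR x, ?_⟩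
  have h1 : (u : X →L[ℂ] X) x = R x := by
    rw [hu]
    have : C x + R x - μ • x = 0 := by simpa [Algebra.algebraMap_eq_smul_one] using hx
    simp only [_root_.sub_apply, Algebra.algebraMap_eq_smul_one,
      _root_.smul_apply, one_apply_eq_self]
    rw [← sub_eq_zero, ← neg_eq_zero, ← this]
    abel
  change (↑u⁻¹ : X →L[ℂ] X) (R x) = x
  rw [← h1]
  change ((↑u⁻¹ : X →L[ℂ] X) * (u : X →L[ℂ] X)) x = x
  rw [Units.inv_mul, one_apply_eq_self]

theorem IsEssContraction.exists_norm_pow_lt_one (hL : IsEssContraction L)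
    (h : ∀ μ : ℂ, 1 ≤ ‖μ‖ → ∀ x, L x = μ • x → x = 0) : ∃ n : ℕ, 0 < n ∧ ‖L ^ n‖ < 1 := by
  rcases subsingleton_or_nontrivial X with hX | hX
  · refine ⟨1, one_pos, ?_⟩
    rw [Subsingleton.elim (L ^ 1) 0, norm_zero]
    exact one_pos
  have h1 : spectralRadius ℂ L < (1 : NNReal) := spectrum.spectralRadius_lt_of_forall_lt L
    fun z hz => by
      by_contra! hz'
      obtain ⟨x, hx, hx'⟩ := hL.exists_eigenvector (by exact_mod_cast hz') hz
      exact hx (h z (by exact_mod_cast hz') x hx')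
  obtain ⟨n, h2, h3⟩ := (((spectrum.pow_nnnorm_pow_one_div_tendsto_nhds_spectralRadius L).eventually
    (gt_mem_nhds h1)).and (eventually_gt_atTop 0)).exists
  refine ⟨n, h3, ?_⟩
  by_contra! h4
  refine h2.not_ge ?_
  rw [ENNReal.coe_one]
  exact ENNReal.one_le_rpow (by exact_mod_cast h4) (by positivity)

end Normed

variable [InnerProductSpace ℂ X] [CompleteSpace X] {L : X →L[ℂ] X}

theorem IsEssContraction.adjoint (hL : IsEssContraction L) :
    IsEssContraction (ContinuousLinearMap.adjoint L) := by
  obtain ⟨C, R, V, rfl, hC, hV, hR⟩ := hL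
  refine ⟨ContinuousLinearMap.adjoint C, ContinuousLinearMap.adjoint R,
    V.map (ContinuousLinearMap.adjoint R : X →ₗ[ℂ] X), map_add _ _ _, by simpa using hC,
    inferInstance, fun x => ⟨V.starProjection x, V.starProjection_apply_mem x, ?_⟩⟩
  -- The adjoint of `R` only sees the projection onto the range of `R`.
  refine ext_inner_right ℂ fun y => ?_
  change inner ℂ (ContinuousLinearMap.adjoint R (V.starProjection x)) y = _
  rw [ContinuousLinearMap.adjoint_inner_left, ContinuousLinearMap.adjoint_inner_left,
    V.inner_starProjection_left_eq_right, V.starProjection_eq_self_iff.2 (hR y)]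

end EssContraction

end

/-! ### Unstable flags -/

section

section Flag

/-- `UnstableFlag L n W` says that `W` is the top of a chain of `n + 1` `L`-invariant subspaces,
starting at `⊥` and growing by one dimension at a time, on whose successive quotients `L` acts by
scalars of modulus at least one. -/
inductive UnstableFlag {X : Type*} [NormedAddCommGroup X] [NormedSpace ℂ X] (L : X →L[ℂ] X) :
    ℕ → Submodule ℂ X → Prop
  | bot : UnstableFlag L 0 ⊥
  | extend {n : ℕ} {W : Submodule ℂ X} {v : X} {μ : ℂ} (h : UnstableFlag L n W) (hv : v ∉ W)
      (hLv : L v - μ • v ∈ W) (hμ : 1 ≤ ‖μ‖) : UnstableFlag L (n + 1) (W ⊔ ℂ ∙ v)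

theorem exists_add_smul_eq_of_mem_sup {X : Type*} [AddCommGroup X] [Module ℂ X]
    {W : Submodule ℂ X} {v x : X} (hx : x ∈ W ⊔ ℂ ∙ v) : ∃ w ∈ W, ∃ a : ℂ, w + a • v = x := by
  obtain ⟨w, hw, z, hz, h⟩ := Submodule.mem_sup.1 hx
  obtain ⟨a, rfl⟩ := Submodule.mem_span_singleton.1 hz
  exact ⟨w, hw, a, h⟩

namespace UnstableFlag

variable {X : Type*} [NormedAddCommGroup X]

section Normed

variable [NormedSpace ℂ X] {L L' : X →L[ℂ] X} {n : ℕ} {W : Submodule ℂ X}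

theorem map_mem (h : UnstableFlag L n W) : ∀ {x : X}, x ∈ W → L x ∈ W := by
  induction h with
  | bot => intro x hx; simp_all
  | @extend n W v μ h hv hLv hμ ih =>
    intro x hx
    obtain ⟨w, hw, a, rfl⟩ := exists_add_smul_eq_of_mem_sup hx
    rw [map_add, map_smul]
    refine Submodule.add_mem _ (Submodule.mem_sup_left (ih hw)) (Submodule.smul_mem _ _ ?_)
    rw [← sub_add_cancel (L v) (μ • v)]
    exact Submodule.add_mem _ (Submodule.mem_sup_left hLv)
      (Submodule.smul_mem _ _ (Submodule.mem_sup_right (Submodule.mem_span_singleton_self v)))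

theorem finiteDimensional (h : UnstableFlag L n W) : FiniteDimensional ℂ W := by
  induction h with
  | bot => infer_instance
  | extend => infer_instance

theorem eq_zero_of_apply_eq_smul (h : UnstableFlag L n W) {ν : ℂ} (hν : ‖ν‖ < 1) :
    ∀ {x : X}, x ∈ W → L x = ν • x → x = 0 := by
  induction h with
  | bot => intro x hx _; simpa using hx
  | @extend n W v μ h hv hLv hμ ih =>
    intro x hx hLx
    obtain ⟨w, hw, a, rfl⟩ := exists_add_smul_eq_of_mem_sup hx
    have h1 : (a * (μ - ν)) • v ∈ W := by
      have : (a * (μ - ν)) • v = -(L w - ν • w) - a • (L v - μ • v) := by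
        rw [map_add, map_smul, smul_add, ← sub_eq_zero] at hLx
        rw [← sub_eq_zero, ← hLx]
        module
      rw [this]
      exact W.sub_mem (W.neg_mem (W.sub_mem (h.map_mem hw) (W.smul_mem _ hw))) (W.smul_mem _ hLv)
    have h2 : μ - ν ≠ 0 := by
      rintro h2
      rw [sub_eq_zero.1 h2] at hμ
      linarith
    have h3 : a = 0 := by
      by_contra h3
      exact hv ((W.smul_mem_iff (mul_ne_zero h3 h2)).1 h1)
    subst h3
    rw [zero_smul, add_zero] at hLx ⊢
    exact ih hw hLx

/-- If `L` and `L'` agree modulo a common eigenvector `φ` that is stable for `L'` and unstable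
for `L`, then every flag of `L'` extends by `φ` to a longer flag of `L`. -/
theorem sup_span_singleton (h : UnstableFlag L' n W) {φ : X} (hφ : φ ≠ 0)
    {μ ν : ℂ} (hμ : 1 ≤ ‖μ‖) (hν : ‖ν‖ < 1) (hLφ : L φ = μ • φ) (hLφ' : L' φ = ν • φ)
    (hLL : ∀ x, L' x - L x ∈ ℂ ∙ φ) : UnstableFlag L (n + 1) (W ⊔ ℂ ∙ φ) := by
  induction h with
  | bot => exact extend bot (by simpa using hφ) (by simp [hLφ]) hμ
  | @extend n W v μ' h hv hLv hμ' ih =>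
    rw [sup_right_comm]
    refine extend ih (fun hmem => ?_) ?_ hμ'
    · obtain ⟨w, hw, a, rfl⟩ := exists_add_smul_eq_of_mem_sup hmem
      have ha : a ≠ 0 := by
        rintro rfl
        exact hv (by simpa using hw)
      refine hφ ((extend h hv hLv hμ').eq_zero_of_apply_eq_smul hν ?_ hLφ')
      rw [← Submodule.smul_mem_iff _ ha]
      have h1 := Submodule.mem_span_singleton_self (R := ℂ) (w + a • φ)
      simpa using Submodule.sub_mem _ (Submodule.mem_sup_right h1) (Submodule.mem_sup_left hw)
    · rw [show L v - μ' • v = (L' v - μ' • v) - (L' v - L v) by abel]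
      exact Submodule.sub_mem _ (Submodule.mem_sup_left hLv) (Submodule.mem_sup_right (hLL v))

end Normed

variable [InnerProductSpace ℂ X] {L : X →L[ℂ] X} {n : ℕ} {W : Submodule ℂ X}

theorem exists_orthonormal (h : UnstableFlag L n W) :
    ∃ u : Fin n → X, Orthonormal ℂ u ∧ (∀ i, u i ∈ W) ∧ ∀ i, 1 ≤ ‖inner ℂ (u i) (L (u i))‖ := by
  induction h with
  | bot => exact ⟨Fin.elim0, ⟨fun i => i.elim0, fun i => i.elim0⟩, fun i => i.elim0,
      fun i => i.elim0⟩
  | @extend n W v μ h hv hLv hμ ih =>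
    obtain ⟨u, hu, huW, hLu⟩ := ih
    have := h.finiteDimensional
    -- Normalize the component of `v` orthogonal to `W`.
    set w := v - W.starProjection v with hw
    have hPv := W.starProjection_apply_mem v
    have hw0 : w ≠ 0 := fun h0 => hv (by rw [sub_eq_zero.1 h0]; exact hPv)
    have hwW : ∀ x ∈ W, inner ℂ x w = 0 := fun x hx =>
      W.inner_right_of_mem_orthogonal hx (W.sub_starProjection_mem_orthogonal v)
    set z := ((‖w‖⁻¹ : ℝ) : ℂ) • w with hz
    have hz1 : ‖z‖ = 1 := by
      rw [hz, norm_smul, Complex.norm_real, norm_inv, norm_norm, inv_mul_cancel₀ (by simpa)]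
    have hzW : ∀ x ∈ W, inner ℂ x z = 0 := fun x hx => by
      rw [hz, inner_smul_right, hwW x hx, mul_zero]
    have hLz : L z - μ • z ∈ W := by
      have : L z - μ • z = ((‖w‖⁻¹ : ℝ) : ℂ) • ((L v - μ • v) -
          (L (W.starProjection v) - μ • W.starProjection v)) := by
        rw [hz, hw, map_smul, map_sub]
        module
      rw [this]
      exact W.smul_mem _ (W.sub_mem hLv (W.sub_mem (h.map_mem hPv) (W.smul_mem _ hPv)))
    refine ⟨Fin.snoc u z, ?_, ?_, ?_⟩
    · rw [orthonormal_iff_ite] at hu ⊢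
      intro i j
      induction i using Fin.lastCases with
      | last =>
        induction j using Fin.lastCases with
        | last => simp [hz1]
        | cast j => simp [inner_eq_zero_symm.1 (hzW _ (huW j)), (Fin.castSucc_lt_last j).ne']
      | cast i =>
        induction j using Fin.lastCases with
        | last => simp [hzW _ (huW i), (Fin.castSucc_lt_last i).ne]
        | cast j => simp [hu i j]
    · intro i
      induction i using Fin.lastCases with
      | last =>
        rw [Fin.snoc_last, hz, hw]
        exact Submodule.smul_mem _ _ (Submodule.sub_mem _
          (Submodule.mem_sup_right (Submodule.mem_span_singleton_self v))
          (Submodule.mem_sup_left hPv))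
      | cast i => simpa using Submodule.mem_sup_left (huW i)
    · intro i
      induction i using Fin.lastCases with
      | last =>
        rw [Fin.snoc_last]
        have h1 : inner ℂ z (L z) = μ := by
          rw [← sub_add_cancel (L z) (μ • z), inner_add_right,
            inner_eq_zero_symm.1 (hzW _ hLz), inner_smul_right, inner_self_eq_norm_sq_to_K, hz1]
          simp
        rw [h1]
        exact hμ
      | cast i => simpa using hLu i

end UnstableFlag

variable {X : Type*} [NormedAddCommGroup X] [InnerProductSpace ℂ X]

/-- The unstable flags of an essential contraction have bounded length: an orthonormal system
adapted to a flag has to keep a fixed amount of its mass in the range of the finite-rank part, so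
Bessel's inequality limits its size. -/
theorem IsEssContraction.exists_flag_bound {L : X →L[ℂ] X} (hL : IsEssContraction L) :
    ∃ N : ℕ, ∀ n W, UnstableFlag L n W → n ≤ N := by
  obtain ⟨C, R, V, rfl, hC, hV, hR⟩ := hL
  let e := stdOrthonormalBasis ℂ V
  set d := Module.finrank ℂ V
  set δ := 1 - ‖C‖ with hδ
  have hδ0 : 0 < δ := by linarith
  refine ⟨⌈‖R‖ ^ 2 * d / δ ^ 2⌉₊, fun n W h => ?_⟩
  obtain ⟨u, hu, -, hLu⟩ := h.exists_orthonormal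
  have hmass : ∀ i, δ ^ 2 ≤ ‖R‖ ^ 2 * ∑ j, ‖inner ℂ (u i) (e j : X)‖ ^ 2 := fun i => by
    have hn := hu.1 i
    have h1 : inner ℂ (u i) (R (u i)) = inner ℂ (V.starProjection (u i)) (R (u i)) := by
      rw [V.inner_starProjection_left_eq_right, V.starProjection_eq_self_iff.2 (hR _)]
    have h2 : δ ≤ ‖V.starProjection (u i)‖ * ‖R‖ := by
      have h3 := hLu i
      rw [_root_.add_apply, inner_add_right, h1] at h3
      have h4 : ‖inner ℂ (u i) (C (u i))‖ ≤ ‖C‖ := by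
        refine (norm_inner_le_norm _ _).trans ?_
        simpa [hn] using C.le_opNorm (u i)
      have h5 : ‖inner ℂ (V.starProjection (u i)) (R (u i))‖ ≤
          ‖V.starProjection (u i)‖ * ‖R‖ := by
        refine (norm_inner_le_norm _ _).trans ?_
        gcongr
        simpa [hn] using R.le_opNorm (u i)
      linarith [norm_add_le (inner ℂ (u i) (C (u i)))
        (inner ℂ (V.starProjection (u i)) (R (u i)))]
    have h6 : ‖V.starProjection (u i)‖ ^ 2 = ∑ j, ‖inner ℂ (u i) (e j : X)‖ ^ 2 := by
      have := e.sum_sq_norm_inner_left (V.orthogonalProjectionOnto (u i))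
      rw [Submodule.starProjection_apply, Submodule.norm_coe, ← this]
      simp
    calc δ ^ 2 ≤ (‖V.starProjection (u i)‖ * ‖R‖) ^ 2 := by gcongr
      _ = _ := by rw [mul_pow, h6, mul_comm]
  have hbessel : ∑ i, ∑ j, ‖inner ℂ (u i) (e j : X)‖ ^ 2 ≤ d := by
    rw [Finset.sum_comm]
    calc ∑ j, ∑ i, ‖inner ℂ (u i) (e j : X)‖ ^ 2 ≤ ∑ j : Fin d, (1 : ℝ) := by
          refine Finset.sum_le_sum fun j _ => (hu.sum_inner_products_le _).trans ?_
          rw [Submodule.norm_coe, e.orthonormal.1 j, one_pow]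
      _ = d := by simp
  have htotal : n * δ ^ 2 ≤ ‖R‖ ^ 2 * d := by
    calc n * δ ^ 2 = ∑ i : Fin n, δ ^ 2 := by simp
      _ ≤ ∑ i, ‖R‖ ^ 2 * ∑ j, ‖inner ℂ (u i) (e j : X)‖ ^ 2 := Finset.sum_le_sum fun i _ => hmass i
      _ ≤ ‖R‖ ^ 2 * d := by
        rw [← Finset.mul_sum]
        gcongr
  have : (n : ℝ) ≤ ‖R‖ ^ 2 * d / δ ^ 2 := (le_div_iff₀ (by positivity)).2 htotal
  exact_mod_cast this.trans (Nat.le_ceil _)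

end Flag

end

/-! ### Stabilization by moving eigenvalues -/

section

/-- A commuting family of endomorphisms of a nonzero finite-dimensional invariant subspace has a
common eigenvector there; an eigenspace of one member is invariant under all others. -/
theorem exists_common_eigenvector {V ι : Type*} [AddCommGroup V] [Module ℂ V]
    (N : ι → V →ₗ[ℂ] V) (hN : ∀ i j x, N i (N j x) = N j (N i x)) (K : Submodule ℂ V)
    [FiniteDimensional ℂ K] (hK : K ≠ ⊥) (hKN : ∀ i, ∀ x ∈ K, N i x ∈ K) :
    ∃ φ ∈ K, φ ≠ 0 ∧ ∀ i, ∃ c : ℂ, N i φ = c • φ := by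
  induction hn : Module.finrank ℂ K using Nat.strong_induction_on generalizing K with
  | _ n ih =>
    by_cases H : ∀ i, ∃ c : ℂ, ∀ x ∈ K, N i x = c • x
    · obtain ⟨φ, hφ, hφ0⟩ := Submodule.exists_mem_ne_zero_of_ne_bot hK
      exact ⟨φ, hφ, hφ0, fun i => (H i).imp fun c hc => hc φ hφ⟩
    · push Not at H
      obtain ⟨i, hi⟩ := H
      have : Nontrivial K := Submodule.nontrivial_iff_ne_bot.2 hK
      obtain ⟨c, hc⟩ := Module.End.exists_eigenvalue ((N i).restrict (hKN i))
      obtain ⟨x, hx⟩ := hc.exists_hasEigenvector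
      have hx1 : N i x = c • (x : V) := by
        simpa using congrArg Subtype.val hx.apply_eq_smul
      let K' : Submodule ℂ V := K ⊓ LinearMap.ker (N i - c • LinearMap.id)
      have hmem : ∀ y, y ∈ K' ↔ y ∈ K ∧ N i y = c • y := fun y => by
        simp [K', sub_eq_zero]
      have hlt : K' < K := by
        refine lt_of_le_of_ne inf_le_left fun h => ?_
        obtain ⟨y, hy, hy'⟩ := hi c
        exact hy' ((hmem y).1 (h ▸ hy)).2
      have : FiniteDimensional ℂ K' := Submodule.finiteDimensional_of_le hlt.le
      obtain ⟨φ, hφ, h⟩ := ih _ (hn ▸ Submodule.finrank_lt_finrank_of_lt hlt) K'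
        (fun h => hx.2 (Subtype.ext
          ((Submodule.eq_bot_iff _).1 h x ((hmem x).2 ⟨x.2, hx1⟩))))
        (fun j y hy => (hmem _).2 ⟨hKN j y ((hmem y).1 hy).1, by
          rw [hN, ((hmem y).1 hy).2, map_smul]⟩) rfl
      exact ⟨φ, hlt.le hφ, h⟩

variable {X : Type*} [NormedAddCommGroup X] [InnerProductSpace ℂ X]

theorem IsExpStabilizable.of_feedback {U : Type*} [NormedAddCommGroup U] [NormedSpace ℂ U]
    {A : X →ₗ.[ℂ] X} {B : U →L[ℂ] X} (F : X →L[ℂ] U)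
    (h : IsExpStabilizable (((B.comp F : X →L[ℂ] X) : X →ₗ[ℂ] X) +ᵥ A) B) :
    IsExpStabilizable A B := by
  obtain ⟨F', T, hT, hgen, hst⟩ := h
  refine ⟨F' + F, T, hT, ?_, hst⟩
  rw [vadd_vadd] at hgen
  convert hgen using 2
  ext x
  simp

variable [CompleteSpace X]

/-- An unstable eigenvector of the adjoint of a single operator `T τ` yields an unstable
eigenvector of the adjoint of the generator: the eigenspace is finite-dimensional and invariant
under the commuting family of all adjoints, hence contains a common eigenvector. -/
theorem exists_unstable_eigenfunctional {T : ℝ → X →L[ℂ] X} {A : X →ₗ.[ℂ] X}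
    (hT : IsC0Semigroup T) (hA : IsGenerator A T) {τ : ℝ} (hτ : 0 < τ)
    (hL : IsEssContraction (T τ)) {μ : ℂ} (hμ : 1 ≤ ‖μ‖) {x : X} (hx : x ≠ 0)
    (hLx : ContinuousLinearMap.adjoint (T τ) x = μ • x) :
    ∃ φ : X, φ ≠ 0 ∧ ∃ s : ℂ, 0 ≤ s.re ∧
      ∀ y z, (y, z) ∈ A.graph → inner ℂ φ z = s * inner ℂ φ y := by
  let N : {t : ℝ // 0 ≤ t} → X →ₗ[ℂ] X := fun t => (ContinuousLinearMap.adjoint (T t.1) : X →L[ℂ] X)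
  have hN : ∀ i j x, N i (N j x) = N j (N i x) := fun i j x => by
    have h := congrArg ContinuousLinearMap.adjoint (hT.commute i.2 j.2)
    rw [ContinuousLinearMap.mul_def, ContinuousLinearMap.mul_def,
      ContinuousLinearMap.adjoint_comp, ContinuousLinearMap.adjoint_comp] at h
    exact (congrArg (fun F : X →L[ℂ] X => F x) h).symm
  have := hL.adjoint.finiteDimensional_eigenspace hμ
  set K := LinearMap.ker ((ContinuousLinearMap.adjoint (T τ) - algebraMap ℂ (X →L[ℂ] X) μ :
    X →L[ℂ] X) : X →ₗ[ℂ] X) with hKdef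
  have hmem : ∀ y, y ∈ K ↔ N ⟨τ, hτ.le⟩ y = μ • y := fun y => by
    simp [K, N, sub_eq_zero, Algebra.algebraMap_eq_smul_one]
  obtain ⟨φ, hφK, hφ0, hφ⟩ := exists_common_eigenvector N hN K
    (fun h => hx ((Submodule.eq_bot_iff _).1 h x ((hmem x).2 hLx)))
    (fun i y hy => (hmem _).2 (by rw [hN, (hmem y).1 hy, map_smul]))
  choose c hc using hφ
  have hinner : ∀ t (ht : 0 ≤ t) y, inner ℂ φ (T t y) = star (c ⟨t, ht⟩) * inner ℂ φ y :=
    fun t ht y => by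
      rw [← ContinuousLinearMap.adjoint_inner_left]
      change inner ℂ (N ⟨t, ht⟩ φ) y = _
      rw [hc, inner_smul_left]
      rfl
  have hd := hT.dense_domain hA
  obtain ⟨y₀, hy₀, hφy⟩ : ∃ y ∈ A.domain, inner ℂ φ y ≠ 0 := by
    by_contra! H
    exact hφ0 (hd.eq_zero_of_inner_left ℂ fun y hy => H y hy)
  obtain ⟨z₀, hyz⟩ := LinearPMap.mem_domain_iff.1 hy₀
  have hquot : ∀ y z, (y, z) ∈ A.graph → Tendsto (fun t : ℝ =>
      ((t : ℂ)⁻¹) * (inner ℂ φ (T t y) - inner ℂ φ y)) (𝓝[>] 0) (𝓝 (inner ℂ φ z)) :=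
    fun y z h => by
      refine (((innerSL ℂ φ).continuous.tendsto z).comp ((hA y z).1 h)).congr fun t => ?_
      simp [inner_smul_right, inner_sub_right]
  -- The factors by which `(T t)^*` scales `φ` are differentiable at `0`, as seen on `y₀`.
  set s := inner ℂ φ z₀ / inner ℂ φ y₀ with hs
  have hgen : ∀ y z, (y, z) ∈ A.graph → inner ℂ φ z = s * inner ℂ φ y := fun y z h => by
    refine tendsto_nhds_unique (hquot y z h) ?_
    have h1 := ((hquot y₀ z₀ hyz).div_const (inner ℂ φ y₀)).mul_const (inner ℂ φ y)
    refine h1.congr' ?_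
    filter_upwards [self_mem_nhdsWithin] with t ht
    rw [hinner t (le_of_lt ht), hinner t (le_of_lt ht)]
    field_simp
  refine ⟨φ, hφ0, s, ?_, hgen⟩
  have h1 := hT.functional_apply hA hd (φ := innerSL ℂ φ) hgen hτ.le φ
  simp only [innerSL_apply_apply] at h1
  rw [← ContinuousLinearMap.adjoint_inner_left] at h1
  change inner ℂ (N ⟨τ, hτ.le⟩ φ) φ = _ at h1
  rw [(hmem φ).1 hφK, inner_smul_left] at h1
  have h2 := congrArg norm (mul_right_cancel₀ (inner_self_ne_zero.2 hφ0) h1)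
  rw [RCLike.norm_conj, Complex.norm_exp] at h2
  rw [h2, Real.one_le_exp_iff] at hμ
  have h3 : (s * τ).re = s.re * τ := by simp
  rw [h3] at hμ
  exact nonneg_of_mul_nonneg_left hμ hτ

theorem isExpStable_of_no_unstable_eigenvector {T : ℝ → X →L[ℂ] X} (hT : IsC0Semigroup T) {τ : ℝ}
    (hτ : 0 < τ) (hL : IsEssContraction (T τ))
    (h : ∀ μ : ℂ, 1 ≤ ‖μ‖ → ∀ x, ContinuousLinearMap.adjoint (T τ) x = μ • x → x = 0) :
    IsExpStable T := by
  obtain ⟨k, hk, hk'⟩ := hL.adjoint.exists_norm_pow_lt_one h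
  refine hT.isExpStable_of_norm_lt_one (a := k * τ) (by positivity) ?_
  rw [hT.map_nat_mul hτ.le, ← LinearIsometryEquiv.norm_map ContinuousLinearMap.adjoint]
  rwa [← ContinuousLinearMap.star_eq_adjoint, star_pow, ContinuousLinearMap.star_eq_adjoint]

/-- Stabilization by moving one eigenvalue at a time. The hypothesis `hH` is the Hautus condition;
`n` bounds the length of the unstable flags of the adjoint of `T τ`. -/
theorem isExpStabilizable_of_flag_bound {U : Type*} [NormedAddCommGroup U] [NormedSpace ℂ U]
    (B : U →L[ℂ] X) {τ : ℝ} (hτ : 0 < τ) (n : ℕ) : ∀ (A : X →ₗ.[ℂ] X) (T : ℝ → X →L[ℂ] X),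
    IsC0Semigroup T → IsGenerator A T → IsEssContraction (T τ) →
    (∀ k W, UnstableFlag (ContinuousLinearMap.adjoint (T τ)) k W → k ≤ n) →
    (∀ s : ℂ, 0 ≤ s.re → ∀ φ : X, (∀ y z, (y, z) ∈ A.graph → inner ℂ φ z = s * inner ℂ φ y) →
      (∀ u, inner ℂ φ (B u) = 0) → φ = 0) →
    IsExpStabilizable A B := by
  induction n with
  | zero =>
    intro A T hT hA hL hflag _
    refine ⟨0, T, hT, by simpa using hA, isExpStable_of_no_unstable_eigenvector hT hτ hL
      fun μ hμ x hx => ?_⟩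
    by_contra hx0
    have := hflag 1 _ (UnstableFlag.bot.extend (v := x) (by simpa using hx0) (by simp [hx]) hμ)
    omega
  | succ n ih =>
    intro A T hT hA hL hflag hH
    by_cases hev : ∀ μ : ℂ, 1 ≤ ‖μ‖ → ∀ x, ContinuousLinearMap.adjoint (T τ) x = μ • x → x = 0
    · exact ⟨0, T, hT, by simpa using hA, isExpStable_of_no_unstable_eigenvector hT hτ hL hev⟩
    push Not at hev
    obtain ⟨μ, hμ, x, hLx, hx⟩ := hev
    obtain ⟨φ, hφ, s, hs, hgen⟩ := exists_unstable_eigenfunctional hT hA hτ hL hμ hx hLx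
    obtain ⟨u₀, hu₀⟩ : ∃ u, inner ℂ φ (B u) ≠ 0 := by
      by_contra! H
      exact hφ (hH s hs φ hgen H)
    -- The feedback `x ↦ ⟪φ, x⟫ u` with `⟪φ, B u⟫ = -1 - s` moves the eigenvalue `s` to `-1`.
    obtain ⟨u, hφu⟩ : ∃ u, inner ℂ φ (B u) = -1 - s :=
      ⟨((-1 - s) / inner ℂ φ (B u₀)) • u₀, by
        rw [map_smul, inner_smul_right, div_mul_cancel₀ _ hu₀]⟩
    set F : X →L[ℂ] U := (innerSL ℂ φ).smulRight u with hF
    set P : X →L[ℂ] X := B.comp F with hPdef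
    have hPx : ∀ x, P x = inner ℂ φ x • B u := fun x => by simp [P, F]
    have hφT : ∀ t, 0 ≤ t → ∀ x, inner ℂ φ (T t x) = Complex.exp (s * t) * inner ℂ φ x :=
      fun t ht x => hT.functional_apply hA (hT.dense_domain hA) (φ := innerSL ℂ φ) hgen ht x
    have hP : ∀ t, 0 ≤ t → ∀ x, P (T t x) = Complex.exp (s * t) • P x := fun t ht x => by
      rw [hPx, hPx, hφT t ht, smul_smul]
    have hPP : ∀ x, P (P x) = (-1 - s) • P x := fun x => by
      rw [hPx (P x), hPx x, inner_smul_right, hφu, smul_smul, mul_comm]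
    have hT' := hT.isC0Semigroup_perturb hP hPP
    have hA' := hT.isGenerator_perturb (P := P) (q := -1) hA
    have hL' : IsEssContraction (hT.perturb P (-1) τ) :=
      hL.add_finiteRank (W := Submodule.span ℂ {hT.expConv (-1) τ (B u)}) fun x => by
        rw [ContinuousLinearMap.comp_apply, hPx, map_smul]
        exact Submodule.smul_mem _ _ (Submodule.mem_span_singleton_self _)
    -- `φ` is an eigenvector of both adjoints, unstable for `T τ` and stable for the closed loop.
    have hadj : ContinuousLinearMap.adjoint (T τ) φ = star (Complex.exp (s * τ)) • φ := by
      refine ext_inner_right ℂ fun y => ?_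
      rw [ContinuousLinearMap.adjoint_inner_left, hφT τ hτ.le, inner_smul_left]
      simp
    have hBu : ∀ x t, 0 ≤ t → inner ℂ φ (hT.perturb P (-1) t x) =
        Complex.exp (-1 * t) * inner ℂ φ x := fun x t ht => by
      -- `P` only determines `⟪φ, x⟫` because `s ≠ -1`, which holds as `Re s ≥ 0`.
      have hs1 : -1 - s ≠ 0 := fun h => by
        have := congrArg Complex.re h
        simp only [Complex.sub_re, Complex.neg_re, Complex.one_re, Complex.zero_re] at this
        linarith
      have h1 := congrArg (inner ℂ φ) (hT.comp_perturb hP hPP ht x)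
      rw [hPx, hPx, inner_smul_right, inner_smul_right, inner_smul_right, hφu, ← mul_assoc] at h1
      exact mul_right_cancel₀ hs1 h1
    have hadj' : ContinuousLinearMap.adjoint (hT.perturb P (-1) τ) φ =
        star (Complex.exp (-1 * τ)) • φ := by
      refine ext_inner_right ℂ fun y => ?_
      rw [ContinuousLinearMap.adjoint_inner_left, hBu y τ hτ.le, inner_smul_left]
      simp
    refine IsExpStabilizable.of_feedback F (ih _ _ hT' hA' hL' (fun k W hW => ?_) ?_)
    · refine Nat.le_of_succ_le_succ (hflag _ _ (hW.sup_span_singleton hφ ?_ ?_ hadj hadj'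
        fun x => ?_))
      · rw [norm_star, Complex.norm_exp, Real.one_le_exp_iff]
        simp only [Complex.mul_re, Complex.ofReal_re, Complex.ofReal_im, mul_zero, sub_zero]
        positivity
      · rw [norm_star, Complex.norm_exp, Real.exp_lt_one_iff]
        simpa using hτ
      · rw [Submodule.mem_span_singleton]
        refine ⟨star (inner ℂ x (hT.expConv (-1) τ (B u))), ext_inner_right ℂ fun y => ?_⟩
        rw [inner_sub_left, ContinuousLinearMap.adjoint_inner_left,
          ContinuousLinearMap.adjoint_inner_left, hT.perturb_apply, hPx, map_smul,
          inner_add_right, add_sub_cancel_left, inner_smul_left, inner_smul_right, mul_comm,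
          starRingEnd_apply, star_star]
    · intro s' hs' ψ hψ hψB
      refine hH s' hs' ψ (fun y z hyz => ?_) hψB
      have h1 := hψ y (z + P y) ((mem_graph_vadd_iff _ _ _ _).2
        (by rwa [ContinuousLinearMap.coe_coe, add_sub_cancel_right]))
      rwa [inner_add_right, hPx, inner_smul_right, hψB, mul_zero, add_zero] at h1

end

/-! ### Finite-rank feedback and the extended generator -/

section

section Duhamel

variable {X : Type*} [NormedAddCommGroup X] [NormedSpace ℂ X] [CompleteSpace X]
  {T S : ℝ → X →L[ℂ] X} {A : X →ₗ.[ℂ] X} {P : X →L[ℂ] X}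

theorem continuous_duhamel (hT : IsC0Semigroup T) (hS : IsC0Semigroup S) (τ : ℝ) (x : X) :
    Continuous fun r : ℝ => T (max (τ - r) 0) (S (max r 0) x) := by
  rw [continuous_iff_continuousAt]
  intro r
  have h : Continuous fun r : ℝ => max (τ - r) 0 := by fun_prop
  exact hT.tendsto_apply (le_max_right _ _) (Eventually.of_forall fun _ => le_max_right _ _)
    (h.tendsto r) ((hS.continuous_orbit x).tendsto r)

/-- Duhamel's formula in differentiated form: if `S` is generated by the bounded perturbation
`A + P` of the generator `A` of `T`, then `r ↦ T(τ - r) S(r) x` has right derivative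
`T(τ - r) P S(r) x`. -/
theorem hasDerivWithinAt_duhamel (hT : IsC0Semigroup T) (hS : IsC0Semigroup S)
    (hA : IsGenerator A T) (hAS : IsGenerator ((P : X →ₗ[ℂ] X) +ᵥ A) S) {τ r : ℝ} (hr : 0 ≤ r)
    (hrτ : r < τ) {x : X} (hx : x ∈ A.domain) :
    HasDerivWithinAt (fun r : ℝ => T (max (τ - r) 0) (S (max r 0) x))
      (T (τ - r) (P (S r x))) (Ici r) r := by
  obtain ⟨x', hx'⟩ := LinearPMap.mem_domain_iff.1 (show x ∈ ((P : X →ₗ[ℂ] X) +ᵥ A).domain from hx)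
  have h1 := hS.graph_invariant hAS hr hx'
  set y := S r x with hy
  set z := S r x' - P y with hz
  have hyz : (y, z) ∈ A.graph := (mem_graph_vadd_iff _ _ _ _).1 h1
  have h2 : Tendsto (fun h : ℝ => ((h : ℂ)⁻¹) • (S h y - y) - ((h : ℂ)⁻¹) • (T h y - y))
      (𝓝[>] 0) (𝓝 (P y)) := by
    simpa [hz] using ((hAS _ _).1 h1).sub ((hA _ _).1 hyz)
  have hshift : Tendsto (fun r' : ℝ => r' - r) (𝓝[>] r) (𝓝[>] 0) := by
    refine tendsto_nhdsWithin_iff.2 ⟨?_, ?_⟩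
    · have : Continuous fun r' : ℝ => r' - r := by fun_prop
      simpa using (this.tendsto r).mono_left nhdsWithin_le_nhds
    · filter_upwards [self_mem_nhdsWithin] with r' hr'
      simpa using hr'
  have hlt : ∀ᶠ r' in 𝓝[>] r, r' < τ := nhdsWithin_le_nhds (gt_mem_nhds hrτ)
  have hτ' : Tendsto (fun r' : ℝ => τ - r') (𝓝[>] r) (𝓝 (τ - r)) := by
    have : Continuous fun r' : ℝ => τ - r' := by fun_prop
    exact (this.tendsto r).mono_left nhdsWithin_le_nhds
  rw [hasDerivWithinAt_iff_tendsto_slope, Ici_sdiff_left]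
  refine (hT.tendsto_apply (by linarith) ?_ hτ' (h2.comp hshift)).congr' ?_
  · filter_upwards [hlt] with r' h
    linarith
  · filter_upwards [hlt, self_mem_nhdsWithin] with r' h hr'
    have hr' : r < r' := hr'
    have e1 : S r' x = S (r' - r) y := by
      rw [hy, ← hS.add_apply (by linarith) hr, sub_add_cancel]
    have e2 : T (τ - r) y = T (τ - r') (T (r' - r) y) := by
      rw [← hT.add_apply (by linarith) (by linarith), sub_add_sub_cancel]
    rw [slope_def_module, max_eq_left (by linarith : (0 : ℝ) ≤ τ - r'),
      max_eq_left (by linarith : (0 : ℝ) ≤ r'), max_eq_left (by linarith : (0 : ℝ) ≤ τ - r),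
      max_eq_left hr, e1, ← hy, e2, ← map_sub, Function.comp_apply, ← smul_sub,
      sub_sub_sub_cancel_right, map_smul, ← Complex.ofReal_inv, Complex.coe_smul]

end Duhamel

/-- If a finite-rank bounded feedback turns the semigroup `T` into a semigroup `S` with `S τ` of
small norm, then `T τ` is a contraction up to finite rank. The difference is the integral of
`T(τ - r) B F S(r)`, and the operators `T(τ - r) B` form a compact set, so that up to a small error
they all map into one finite-dimensional subspace. -/
theorem isEssContraction_of_feedback {X U : Type*} [NormedAddCommGroup X] [InnerProductSpace ℂ X]
    [CompleteSpace X] [NormedAddCommGroup U] [NormedSpace ℂ U] [FiniteDimensional ℂ U]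
    {T S : ℝ → X →L[ℂ] X} {A : X →ₗ.[ℂ] X} {B : U →L[ℂ] X} {F : X →L[ℂ] U}
    (hT : IsC0Semigroup T) (hS : IsC0Semigroup S) (hA : IsGenerator A T)
    (hAS : IsGenerator (((B.comp F : X →L[ℂ] X) : X →ₗ[ℂ] X) +ᵥ A) S) {τ : ℝ} (hτ : 0 < τ)
    (hSτ : ‖S τ‖ < 1 / 2) : IsEssContraction (T τ) := by
  obtain ⟨M, hM, hb⟩ := hS.exists_bound τ
  set ε : ℝ := 1 / (4 * ((‖F‖ + 1) * M * τ)) with hε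
  have hε0 : 0 < ε := by positivity
  set k : ℝ → U →L[ℂ] X := fun r => (T (max (τ - r) 0)).comp B with hk
  have hkc : Continuous k := continuous_clm_apply.2 fun u => by
    have h : Continuous fun r : ℝ => τ - r := by fun_prop
    exact (hT.continuous_orbit (B u)).comp h
  obtain ⟨t, -, htf, ht⟩ := (isCompact_Icc (a := (0 : ℝ)) (b := τ)).image hkc
    |>.finite_cover_balls hε0
  set V : Submodule ℂ X := htf.toFinset.sup fun f : U →L[ℂ] X => LinearMap.range (f : U →ₗ[ℂ] X)
    with hV
  have hVf : FiniteDimensional ℂ V := inferInstance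
  -- `Q` projects along `V`, hence is small on the range of every `k r`.
  set Q : X →L[ℂ] X := Vᗮ.starProjection with hQ
  have hQ1 : ∀ x, ‖Q x‖ ≤ ‖x‖ := fun x =>
    (Q.le_of_opNorm_le Vᗮ.starProjection_norm_le x).trans (one_mul _).le
  have hQV : ∀ x, x - Q x ∈ V := fun x => by
    rw [hQ, Submodule.starProjection_orthogonal_val, sub_sub_cancel]
    exact V.starProjection_apply_mem x
  have hQk : ∀ r ∈ Icc 0 τ, ∀ u, ‖Q (k r u)‖ ≤ ε * ‖u‖ := fun r hr u => by
    obtain ⟨f, hf, hfr⟩ := mem_iUnion₂.1 (ht ⟨r, hr, rfl⟩)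
    have h1 : Q (f u) = 0 := by
      have hfu : f u ∈ V :=
        (Finset.le_sup (f := fun f : U →L[ℂ] X => LinearMap.range (f : U →ₗ[ℂ] X))
          (htf.mem_toFinset.2 hf)) ⟨u, rfl⟩
      rw [hQ, Submodule.starProjection_orthogonal_val, V.starProjection_eq_self_iff.2 hfu, sub_self]
    rw [← sub_zero (Q (k r u)), ← h1, ← map_sub, ← _root_.sub_apply]
    refine (hQ1 _).trans ((k r - f).le_of_opNorm_le ?_ u)
    rw [← dist_eq_norm]
    exact (Metric.mem_ball.1 hfr).le
  set D := S τ - T τ with hD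
  have hQD : ∀ x ∈ A.domain, ‖Q (D x)‖ ≤ 1 / 4 * ‖x‖ := fun x hx => by
    have hcont : Continuous fun r : ℝ => Q (T (max (τ - r) 0) (S (max r 0) x)) :=
      Q.continuous.comp (continuous_duhamel hT hS τ x)
    have h1 := norm_image_sub_le_of_norm_deriv_right_le_segment (a := 0) (b := τ)
      (C := ε * (‖F‖ * (M * ‖x‖))) hcont.continuousOn
      (fun r hr => (Q.restrictScalars ℝ).hasFDerivAt.comp_hasDerivWithinAt r
          (hasDerivWithinAt_duhamel hT hS hA hAS hr.1 hr.2 hx))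
      (fun r hr => by
        have h2 := hQk r ⟨hr.1, hr.2.le⟩ (F (S r x))
        rw [hk] at h2
        simp only [max_eq_left (by linarith [hr.2] : (0 : ℝ) ≤ τ - r)] at h2
        refine h2.trans (mul_le_mul_of_nonneg_left ?_ hε0.le)
        exact F.le_of_opNorm_le_of_le le_rfl ((S r).le_of_opNorm_le (hb r ⟨hr.1, hr.2.le⟩) x))
      τ ⟨hτ.le, le_rfl⟩
    simp only [sub_self, max_self, max_eq_left hτ.le, hT.zero, hS.zero, one_apply_eq_self,
      sub_zero, ← map_sub] at h1
    refine h1.trans ?_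
    have h3 : ε * ((‖F‖ + 1) * M * τ) = 1 / 4 := by
      rw [hε]
      field_simp
    have h4 : ε * (‖F‖ * (M * ‖x‖)) * τ ≤ ε * ((‖F‖ + 1) * M * τ) * ‖x‖ := by
      have : 0 ≤ ε * M * τ * ‖x‖ := by positivity
      nlinarith
    rwa [h3] at h4
  have hQD' : ‖Q.comp D‖ ≤ 1 / 4 := by
    refine ContinuousLinearMap.opNorm_le_bound _ (by norm_num) fun x => ?_
    have hcl : IsClosed {x | ‖(Q.comp D) x‖ ≤ 1 / 4 * ‖x‖} :=
      isClosed_le (by fun_prop) (by fun_prop)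
    exact closure_minimal hQD hcl (hT.dense_domain hA x)
  refine ⟨S τ - Q.comp D, -(D - Q.comp D), V, ?_, ?_, hVf, fun x => V.neg_mem (hQV (D x))⟩
  · rw [hD]
    abel
  · linarith [norm_sub_le (S τ) (Q.comp D)]

section Ext

variable {X₀ : Type*} [NormedAddCommGroup X₀] [InnerProductSpace ℂ X₀] {m : ℕ}

/-- Membership in the graph, with the coupling `G` and the scalar `η` split off from `A₀`. -/
theorem mem_graph_extA_iff (A₀ : X₀ →ₗ.[ℂ] X₀) (G : Inp m →L[ℂ] X₀) (η : ℝ) (z w : ExtState X₀ m) :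
    (z, w) ∈ (extA A₀ G η).graph ↔
      (z.fst, w.fst - G z.snd) ∈ A₀.graph ∧ w.snd = (η : ℂ) • z.snd := by
  simp only [LinearPMap.mem_graph_iff, Subtype.exists, exists_and_left, exists_eq_left]
  constructor
  · rintro ⟨hz, rfl⟩
    exact ⟨⟨hz, (add_sub_cancel_right _ _).symm⟩, rfl⟩
  · rintro ⟨⟨hz, h1⟩, h2⟩
    refine ⟨hz, ?_⟩
    change WithLp.toLp 2 (A₀ ⟨z.fst, hz⟩ + G z.snd, (η : ℂ) • z.snd) = w
    rw [h1, sub_add_cancel, ← h2]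
    rfl

/-- The operator `F ⊕ 1` on `X₀ × ℂ^m`. -/
noncomputable def diagOne (F : X₀ →L[ℂ] X₀) : ExtState X₀ m →L[ℂ] ExtState X₀ m :=
  ((WithLp.prodContinuousLinearEquiv 2 ℂ X₀ (Inp m)).symm :
      (X₀ × Inp m) →L[ℂ] ExtState X₀ m).comp
    ((F.prodMap (ContinuousLinearMap.id ℂ (Inp m))).comp
      (WithLp.prodContinuousLinearEquiv 2 ℂ X₀ (Inp m) : ExtState X₀ m →L[ℂ] X₀ × Inp m))

theorem diagOne_apply (F : X₀ →L[ℂ] X₀) (z : ExtState X₀ m) :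
    diagOne F z = WithLp.toLp 2 (F z.fst, z.snd) := rfl

/-- The part `[[0, G], [0, η I]]` of the extended operator, which is bounded. -/
noncomputable def extCoupling (G : Inp m →L[ℂ] X₀) (η : ℝ) : ExtState X₀ m →L[ℂ] ExtState X₀ m :=
  ((WithLp.prodContinuousLinearEquiv 2 ℂ X₀ (Inp m)).symm :
      (X₀ × Inp m) →L[ℂ] ExtState X₀ m).comp
    ((G.prod ((η : ℂ) • ContinuousLinearMap.id ℂ (Inp m))).comp
      ((ContinuousLinearMap.snd ℂ X₀ (Inp m)).comp
        (WithLp.prodContinuousLinearEquiv 2 ℂ X₀ (Inp m) : ExtState X₀ m →L[ℂ] X₀ × Inp m)))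

theorem extCoupling_apply (G : Inp m →L[ℂ] X₀) (η : ℝ) (z : ExtState X₀ m) :
    extCoupling G η z = WithLp.toLp 2 (G z.snd, (η : ℂ) • z.snd) := rfl

theorem extA_eq_vadd (A₀ : X₀ →ₗ.[ℂ] X₀) (G : Inp m →L[ℂ] X₀) (η : ℝ) :
    extA A₀ G η = (extCoupling G η : ExtState X₀ m →ₗ[ℂ] ExtState X₀ m) +ᵥ extA A₀ 0 0 := by
  refine LinearPMap.eq_of_eq_graph (Submodule.ext fun ⟨z, w⟩ => ?_)
  rw [mem_graph_vadd_iff, mem_graph_extA_iff, mem_graph_extA_iff, ContinuousLinearMap.coe_coe,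
    extCoupling_apply]
  simp [sub_eq_zero]

theorem isC0Semigroup_diagOne {T : ℝ → X₀ →L[ℂ] X₀} (hT : IsC0Semigroup T) :
    IsC0Semigroup fun t => (diagOne (T t) : ExtState X₀ m →L[ℂ] ExtState X₀ m) where
  zero := by
    ext z : 1
    rw [diagOne_apply, hT.zero]
    rfl
  add s t hs ht := by
    ext z : 1
    change diagOne _ z = diagOne _ (diagOne _ z)
    simp [diagOne_apply, hT.add_apply hs ht]
  strongly_continuous z := by
    exact ((WithLp.prodContinuousLinearEquiv 2 ℂ X₀ (Inp m)).symm.continuous.tendsto _).comp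
      ((hT.strongly_continuous z.fst).prodMk_nhds tendsto_const_nhds)

theorem isGenerator_diagOne {T : ℝ → X₀ →L[ℂ] X₀} {A₀ : X₀ →ₗ.[ℂ] X₀} (hA : IsGenerator A₀ T) :
    IsGenerator (extA A₀ (0 : Inp m →L[ℂ] X₀) 0) fun t => diagOne (T t) := by
  intro z w
  rw [mem_graph_extA_iff]
  simp only [_root_.zero_apply, sub_zero, Complex.ofReal_zero, zero_smul]
  rw [hA]
  have hq : ∀ t : ℝ, ((t : ℂ)⁻¹) • (diagOne (T t) z - z) =
      WithLp.toLp 2 (((t : ℂ)⁻¹) • (T t z.fst - z.fst), (0 : Inp m)) := fun t => by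
    have : diagOne (T t) z - z = WithLp.toLp 2 (T t z.fst - z.fst, z.snd - z.snd) := rfl
    rw [this, sub_self, ← WithLp.toLp_smul, Prod.smul_mk, smul_zero]
  simp only [hq]
  constructor
  · rintro ⟨h1, h2⟩
    have := ((WithLp.prodContinuousLinearEquiv 2 ℂ X₀ (Inp m)).symm.continuous.tendsto _).comp
      (h1.prodMk_nhds (tendsto_const_nhds (x := (0 : Inp m))))
    have hw : w = WithLp.toLp 2 (w.fst, (0 : Inp m)) := by
      rw [← h2]
      rfl
    rw [hw]
    exact this
  · intro h
    have h1 := ((WithLp.prodContinuousLinearEquiv 2 ℂ X₀ (Inp m)).continuous.tendsto _).comp h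
    exact ⟨(continuous_fst.tendsto _).comp h1,
      tendsto_nhds_unique ((continuous_snd.tendsto _).comp h1) tendsto_const_nhds⟩

end Ext

end

/-! ### The Hautus test for the extended system -/

section


section Ext

variable {X₀ : Type*} [NormedAddCommGroup X₀] [InnerProductSpace ℂ X₀] {m : ℕ}

theorem isEssContraction_diagOne {L : X₀ →L[ℂ] X₀} (hL : IsEssContraction L) :
    IsEssContraction (diagOne L : ExtState X₀ m →L[ℂ] ExtState X₀ m) := by
  obtain ⟨C, R, V, rfl, hC, hV, hR⟩ := hL
  let ι : X₀ × Inp m →L[ℂ] ExtState X₀ m := (WithLp.prodContinuousLinearEquiv 2 ℂ X₀ (Inp m)).symm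
  let C' : ExtState X₀ m →L[ℂ] ExtState X₀ m :=
    ι.comp ((ContinuousLinearMap.inl ℂ X₀ (Inp m)).comp (C.comp (WithLp.fstL 2 ℂ X₀ (Inp m))))
  have hC' : ∀ z, C' z = WithLp.toLp 2 (C z.fst, (0 : Inp m)) := fun z => rfl
  refine ⟨C', diagOne (C + R) - C', (V.prod ⊤).map (ι : X₀ × Inp m →ₗ[ℂ] ExtState X₀ m),
    (add_sub_cancel _ _).symm, lt_of_le_of_lt ?_ hC, ?_, fun z => ⟨(R z.fst, z.snd), ?_, ?_⟩⟩
  · refine ContinuousLinearMap.opNorm_le_bound _ (norm_nonneg _) fun z => ?_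
    rw [hC', WithLp.norm_toLp_fst]
    exact C.le_opNorm_of_le (WithLp.norm_fst_le _ z)
  · have : FiniteDimensional ℂ (V.prod (⊤ : Submodule ℂ (Inp m))) :=
      (Submodule.fg_iff_finiteDimensional _).1 ((V.fg_iff_finiteDimensional.2 hV).prod
        ((Submodule.fg_iff_finiteDimensional _).2 inferInstance))
    infer_instance
  · exact ⟨hR _, trivial⟩
  · change WithLp.toLp 2 (R z.fst, z.snd) =
      WithLp.toLp 2 ((C + R) z.fst, z.snd) - WithLp.toLp 2 (C z.fst, (0 : Inp m))
    rw [← WithLp.toLp_sub, Prod.mk_sub_mk, sub_zero, _root_.add_apply, add_sub_cancel_left]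

variable [CompleteSpace X₀]

/-- The Hautus test for the extended system: stabilizability follows once the only vector `p`
annihilated by `(s - A₀)^*` and `(G + (η - s) E)^*`, for `s` in the unstable spectrum of `A₀`,
is zero. -/
theorem isExpStabilizable_ext {A₀ : X₀ →ₗ.[ℂ] X₀} {E G : Inp m →L[ℂ] X₀} {η : ℝ}
    {T : ℝ → X₀ →L[ℂ] X₀} (hT : IsC0Semigroup T) (hA : IsGenerator A₀ T)
    (hstab : IsExpStabilizable A₀ E)
    (hH : ∀ s ∈ specPlus A₀, ∀ p : X₀,
      (∀ y z, (y, z) ∈ A₀.graph → inner ℂ p z = s * inner ℂ p y) →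
      (∀ u, inner ℂ p (G u + ((η : ℂ) - s) • E u) = 0) → p = 0) :
    IsExpStabilizable (extA A₀ G η) (extB E) := by
  obtain ⟨F, S, hS, hAS, hst⟩ := hstab
  obtain ⟨τ, hτ, hSτ⟩ := hst.exists_norm_lt (ε := 1 / 2) (by norm_num)
  have hL := isEssContraction_diagOne (m := m) (isEssContraction_of_feedback hT hS hA hAS hτ hSτ)
  -- The extended operator is `A₀ ⊕ 0`, which generates `T ⊕ 1`, perturbed by the coupling `P`.
  have hT₁ := isC0Semigroup_diagOne (m := m) hT
  have hA₁ := isGenerator_diagOne (m := m) hA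
  set P := extCoupling G η with hPdef
  have hP : ∀ t : ℝ, 0 ≤ t → ∀ z : ExtState X₀ m,
      P (diagOne (T t) z) = Complex.exp (0 * t) • P z := fun t _ z => by
    rw [zero_mul, Complex.exp_zero, one_smul]
    rfl
  have hPP : ∀ z, P (P z) = ((η : ℂ) - 0) • P z := fun z => by
    rw [sub_zero]
    change WithLp.toLp 2 (G ((η : ℂ) • z.snd), (η : ℂ) • (η : ℂ) • z.snd) =
      WithLp.toLp 2 ((η : ℂ) • G z.snd, (η : ℂ) • (η : ℂ) • z.snd)
    rw [map_smul]
  have hT₂ := hT₁.isC0Semigroup_perturb hP hPP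
  have hA₂ := hT₁.isGenerator_perturb (P := P) (q := (η : ℂ)) hA₁
  rw [hPdef, ← extA_eq_vadd, ← hPdef] at hA₂
  have hPfin : ∀ z, P z ∈ LinearMap.range (((WithLp.linearEquiv 2 ℂ (X₀ × Inp m)).symm :
      X₀ × Inp m →ₗ[ℂ] ExtState X₀ m) ∘ₗ ((G : Inp m →ₗ[ℂ] X₀).prod ((η : ℂ) • LinearMap.id))) :=
    fun z => ⟨z.snd, rfl⟩
  have hL₂ : IsEssContraction (hT₁.perturb P η τ) :=
    hL.add_finiteRank (W := Submodule.map (hT₁.expConv η τ : ExtState X₀ m →ₗ[ℂ] ExtState X₀ m) _)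
      fun z => ⟨P z, hPfin z, rfl⟩
  obtain ⟨N, hN⟩ := hL₂.adjoint.exists_flag_bound
  refine isExpStabilizable_of_flag_bound (extB E) hτ N _ _ hT₂ hA₂ hL₂ hN fun s hs φ hφ hφB => ?_
  have hinner : ∀ (x : X₀) (u : Inp m), inner ℂ φ (WithLp.toLp 2 (x, u)) =
      inner ℂ φ.fst x + inner ℂ φ.snd u := fun x u => WithLp.prod_inner_apply _ _
  have h1 : ∀ y z, (y, z) ∈ A₀.graph → inner ℂ φ.fst z = s * inner ℂ φ.fst y := fun y z h => by
    have := hφ (WithLp.toLp 2 (y, 0)) (WithLp.toLp 2 (z, 0))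
      ((mem_graph_extA_iff _ _ _ _ _).2 (by simpa using h))
    simpa [hinner] using this
  have h2 : ∀ u, inner ℂ φ.snd u = inner ℂ φ.fst (E u) := fun u => by
    have := hφB u
    rw [extB_apply, hinner, inner_neg_right, neg_add_eq_zero] at this
    exact this.symm
  -- Testing with `(0, u)` and eliminating the second component of `φ` by `h2`.
  have h3 : ∀ u, inner ℂ φ.fst (G u + ((η : ℂ) - s) • E u) = 0 := fun u => by
    have := hφ (WithLp.toLp 2 (0, u)) (WithLp.toLp 2 (G u, (η : ℂ) • u))
      ((mem_graph_extA_iff _ _ _ _ _).2 (by simp))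
    rw [hinner, hinner, inner_smul_right, h2, inner_zero_right, zero_add] at this
    rw [inner_add_right, inner_smul_right]
    linear_combination this
  have h4 : φ.fst = 0 := by
    by_cases hsp : s ∈ spec A₀
    · exact hH s ⟨hsp, by rwa [Complex.closure_setOfPred_lt_re]⟩ _ h1 h3
    · -- On the resolvent set `s - A₀` is onto, so nothing annihilates its range.
      obtain ⟨R, hR⟩ := not_not.1 hsp
      refine ext_inner_right ℂ fun y => ?_
      have h5 := (mem_graph_shift_iff _ _ _ _).1 ((hR (R y) y).2 rfl)
      have h6 := h1 _ _ h5
      rw [inner_sub_right, inner_smul_right] at h6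
      rw [inner_zero_left]
      linear_combination -h6
  have h5 : φ.snd = 0 := ext_inner_right ℂ fun u => by
    rw [h2, h4, inner_zero_left, inner_zero_left]
  rw [show φ = WithLp.toLp 2 (φ.fst, φ.snd) from rfl, h4, h5]
  rfl

end Ext

section Hautus

variable {X : Type*} [NormedAddCommGroup X] [InnerProductSpace ℂ X] [CompleteSpace X]

theorem mem_kernel_adjoint_shift {A : X →ₗ.[ℂ] X} (hd : Dense (A.domain : Set X)) {s : ℂ} {p : X}
    (h : ∀ y z, (y, z) ∈ A.graph → inner ℂ p z = s * inner ℂ p y) :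
    p ∈ kernel (shift s A).adjoint := by
  change (p, (0 : X)) ∈ (shift s A).adjoint.graph
  rw [LinearPMap.adjoint_graph_eq_graph_adjoint (T := shift s A) hd, Submodule.mem_adjoint_iff]
  intro y z hyz
  have h1 := h _ _ ((mem_graph_shift_iff _ _ _ _).1 hyz)
  rw [inner_sub_right, inner_smul_right] at h1
  have h2 : inner ℂ p z = 0 := by linear_combination -h1
  rw [inner_zero_right, sub_zero, inner_eq_zero_symm]
  exact h2

/-- The Hautus condition is necessary for stabilizability: a left eigenvector with an unstable
eigenvalue that is invisible through `B` would be an eigenfunctional of the stable closed loop. -/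
theorem IsExpStabilizable.eq_zero_of_eigenfunctional {U : Type*} [NormedAddCommGroup U]
    [NormedSpace ℂ U] {A : X →ₗ.[ℂ] X} {B : U →L[ℂ] X} (h : IsExpStabilizable A B) {s : ℂ}
    (hs : 0 ≤ s.re) {p : X} (hp : ∀ y z, (y, z) ∈ A.graph → inner ℂ p z = s * inner ℂ p y)
    (hB : ∀ u, inner ℂ p (B u) = 0) : p = 0 := by
  obtain ⟨F, S, hS, hAS, hst⟩ := h
  have h1 : ∀ t, 0 ≤ t → inner ℂ p (S t p) = Complex.exp (s * t) * inner ℂ p p := fun t ht => by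
    refine hS.functional_apply hAS (hS.dense_domain hAS) (φ := innerSL ℂ p) (fun y z hyz => ?_) ht p
    have h2 := hp _ _ ((mem_graph_vadd_iff _ _ _ _).1 hyz)
    rw [inner_sub_right] at h2
    change inner ℂ p z - inner ℂ p (B (F y)) = _ at h2
    rwa [hB, sub_zero] at h2
  have h3 : Tendsto (fun t => ‖inner ℂ p (S t p)‖) atTop (𝓝 0) := by
    have := (((innerSL ℂ p).continuous.tendsto 0).comp (hst.tendsto_apply p)).norm
    simpa using this
  have h4 : ‖inner ℂ p p‖ ≤ 0 := by
    refine ge_of_tendsto h3 ?_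
    filter_upwards [eventually_ge_atTop 0] with t ht
    rw [h1 t ht, norm_mul, Complex.norm_exp]
    refine le_mul_of_one_le_left (norm_nonneg _) (Real.one_le_exp ?_)
    simp only [Complex.mul_re, Complex.ofReal_re, Complex.ofReal_im, mul_zero, sub_zero]
    positivity
  exact inner_self_eq_zero.1 (norm_le_zero_iff.1 h4)

end Hautus

end

end BCS

theorem lemma3p3 {X₀ : Type*} [NormedAddCommGroup X₀] [InnerProductSpace ℂ X₀] [CompleteSpace X₀]
    {m : ℕ} (𝒜 : X₀ →ₗ.[ℂ] X₀) (𝓑 : 𝒜.domain →ₗ[ℂ] BCS.Inp m)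
    (hbcs : BCS.IsBoundaryControlSystem 𝒜 𝓑)
    (Ad Arc : X₀ →ₗ.[ℂ] X₀) (hdec : BCS.IsDecomposition 𝒜 Ad Arc)
    (η : ℝ) (E : BCS.Inp m →L[ℂ] X₀) (hE : BCS.IsExtension 𝒜 𝓑 Ad η E)
    (A₀ : X₀ →ₗ.[ℂ] X₀) (hA₀ : A₀ = BCS.homPart 𝒜 𝓑)
    (ArcE : BCS.Inp m →L[ℂ] X₀)
    (hArcE : ArcE = BCS.compE Arc E (fun u => hdec.domain_le (hE.mem_domain u)))
    (hstab : BCS.IsExpStabilizable A₀ E) :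
    (ArcE = 0 → BCS.IsExpStabilizable (BCS.extA A₀ ArcE η) (BCS.extB E)) ∧
    (ArcE ≠ 0 →
      (∀ s ∈ BCS.specPlus A₀,
        BCS.kernel (BCS.shift s A₀).adjoint ⊓
          LinearMap.ker (ContinuousLinearMap.adjoint (ArcE + ((η : ℂ) - s) • E)).toLinearMap = ⊥) →
      BCS.IsExpStabilizable (BCS.extA A₀ ArcE η) (BCS.extB E)) := by
  obtain ⟨T, hT, hA⟩ := hbcs.generates
  rw [← hA₀] at hA
  constructor
  · intro h0
    refine BCS.isExpStabilizable_ext hT hA hstab fun s hs p hp hpE => ?_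
    have hs0 : 0 ≤ s.re := by
      have := hs.2
      rwa [Complex.closure_setOfPred_lt_re] at this
    -- `η` lies in the resolvent set, so the factor `η - s` can be cancelled.
    have hηs : (η : ℂ) - s ≠ 0 := fun h => hs.1 (by
      rw [← sub_eq_zero.1 h, hA₀]
      exact hE.mem_resolventSet)
    refine hstab.eq_zero_of_eigenfunctional hs0 hp fun u => ?_
    have h1 := hpE u
    rw [h0, _root_.zero_apply, zero_add, inner_smul_right] at h1
    exact (mul_eq_zero.1 h1).resolve_left hηs
  · intro _ hH
    refine BCS.isExpStabilizable_ext hT hA hstab fun s hs p hp hpE => ?_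
    refine (Submodule.eq_bot_iff _).1 (hH s hs) p
      ⟨BCS.mem_kernel_adjoint_shift (hT.dense_domain hA) hp, ?_⟩
    refine ext_inner_right ℂ fun u => ?_
    rw [inner_zero_left]
    exact (ContinuousLinearMap.adjoint_inner_left _ _ _).trans (hpE u)
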